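/- **Conventions.** A *fusion category* over $\mathbb{C}$ is a finite semisimple $\mathbb{C}$-linear abelian rigid monoidal category $\mathcal{C}$, with bilinear tensor product and finite-dimensional Hom spaces, whose unit object $\mathbf 1$ is simple; thus $\operatorname{End}(\mathbf 1)=\mathbb{C}$. The dual $X^*$ of $X$ comes with $\mathrm{ev}_X:X^*\otimes X\to\mathbf 1$ and $\mathrm{coev}_X:\mathbf 1\to X\otimes X^*$. A *pivotal structure* is a monoidal natural isomorphism $j_X:X\cong X^{**}$. For $f:X\to X^{**}$ put $\mathrm{tr}(f)=\mathrm{ev}_{X^*}\circ(f\otimes\mathrm{id})\circ\mathrm{coev}_X\in\mathbb{C}$, and for $g:X\to X$ put $\mathrm{ptr}(g)=\mathrm{tr}(j_X\circ g)$. A fusion category with pivotal structure $j$ is *spherical* if $\mathrm{tr}(j_X)=\mathrm{tr}(j_{X^*})$ for all $X$. Its global dimension is $\dim(\mathcal{C})=\sum_X \mathrm{ptr}(\mathrm{id}_X)\,\mathrm{ptr}(\mathrm{id}_{X^*})$, the sum being over the isomorphism classes of simple objects. Objects of the Drinfeld center $\mathcal{Z}(\mathcal{C})$ are pairs $\mathbf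 V=(V,\sigma)$ with a half-braiding $\sigma_X:V\otimes X\cong X\otimes V$. Let $u_{\mathbf V}=(\mathrm{ev}_V\otimes\mathrm{id})\circ(\mathrm{id}\otimes\sigma_{V^{**}}^{-1})\circ(\mathrm{coev}_{V^*}\otimes\mathrm{id}):V\to V^{**}$ and $\theta_{\mathbf V}=u_{\mathbf V}^{-1}\circ j_V$, the ribbon structure of $\mathcal{Z}(\mathcal{C})$. For a finite semisimple left $\mathcal{C}$-module category $\mathcal{M}$ with action $\odot$, the dual category $\mathcal{C}^*_{\mathcal{M}}$ has as objects the pairs $\mathbf F=(F,s)$ of a $\mathbb{C}$-linear right exact functor $F:\mathcal{M}\to\mathcal{M}$ and a $\mathcal{C}$-module structure $s_{X,m}:X\odot F(m)\cong F(X\odot m)$; its morphisms are the natural transformations compatible with the module structures. Let $$A_{\mathcal{C}}:\mathcal{Z}(\mathcal{C})\to\mathcal{C}^*_{\mathcal{M}},\qquad (V,\sigma)\mapsto\bigl(V\odot-,\ \sigma^{-1}\odot\mathrm{id}\bigr).$$ For a right (or left) adjoint $K$ of $A_{\mathcal{C}}$, the $n$-th *indicator* of $\mathbf F\in\mathcal{C}^*_{\mathcal{M}}$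 is $$\nu_n(\mathbf F)=\frac{1}{\dim(\mathcal{C})}\,\mathrm{ptr}\bigl(\theta_{K(\mathbf F)}^{\,n}\bigr).$$ **Proposition.** Let $\mathcal{C}$ and $\mathcal{D}$ be spherical fusion categories over $\mathbb{C}$, with pivotal structures $j$ and $j'$. Let $\mathcal{M}$ be a finite semisimple left $\mathcal{D}$-module category with bilinear action which is indecomposable, that is, nonzero and not a direct sum of two nonzero $\mathcal{D}$-module subcategories. Let $\Phi:\mathcal{C}\to\mathcal{D}$ be a ($\mathbb{C}$-linear) tensor equivalence that preserves the pivotal structure: $\xi_X\circ\Phi(j_X)=j'_{\Phi(X)}$ for all $X$, where $\xi_X=(\chi_X^{*})^{-1}\circ\chi_{X^*}:\Phi(X^{**})\cong\Phi(X)^{**}$ and $\chi_X:\Phi(X^*)\cong\Phi(X)^*$ is the canonical isomorphism $(\Phi(\mathrm{ev}_X)\otimes\mathrm{id})\circ(\mathrm{id}\otimes\mathrm{coev}_{\Phi(X)})$ (up to the monoidal constraints of $\Phi$). Regard $\mathcal{M}$ as a left $\mathcal{C}$-module category via $X\odot m:=\Phi(X)\odot m$, with constraints obtained from those of $\mathcal{M}$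 and the monoidal structure of $\Phi$, and let $$\Phi^*:\mathcal{D}^*_{\mathcal{M}}\to\mathcal{C}^*_{\mathcal{M}},\qquad (F,s)\mapsto(F,s_{\Phi(-),-}).$$ Then $A_{\mathcal{C}}$ and $A_{\mathcal{D}}$ have right adjoints, and for every $\mathbf F\in\mathcal{D}^*_{\mathcal{M}}$ and every $n\ge 1$, $$\nu_n(\Phi^*(\mathbf F))=\nu_n(\mathbf F),$$ whichever right adjoints $K$ of $A_{\mathcal{C}}$ and $K'$ of $A_{\mathcal{D}}$ (or, whichever left adjoints of both) are used to compute the two indicators. -/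

import Mathlib

open CategoryTheory MonoidalCategory Limits
noncomputable section
namespace DualFS
universe v u
local postfix:max "✶" => HasRightDual.rightDual
local prefix:max "⋆" => HasLeftDual.leftDual
section
variable {C : Type u} [Category.{v} C] [MonoidalCategory C]

/-- The half-braiding with the unit object is given by the unitors. -/
theorem halfBraiding_unit {V : C} (b : HalfBraiding V) :
    (b.β (𝟙_ C)).hom = (ρ_ V).hom ≫ (λ_ V).inv := by
  have h := b.monoidal (𝟙_ C) (𝟙_ C)
  have n := b.naturality (λ_ (𝟙_ C)).hom
  rw [h] at n
  have e1 : V ◁ (λ_ (𝟙_ C)).hom ≫ (b.β (𝟙_ C)).hom =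
      (α_ _ _ _).inv ≫ (b.β (𝟙_ C)).hom ▷ 𝟙_ C ≫ (ρ_ _).hom := by
    rw [MonoidalCategory.rightUnitor_naturality,
      show V ◁ (λ_ (𝟙_ C)).hom = (α_ _ _ _).inv ≫ (ρ_ (V ⊗ 𝟙_ C)).hom by monoidal,
      Category.assoc]
  rw [e1] at n
  simp only [Category.assoc, cancel_epi] at n
  have e2 : (ρ_ (𝟙_ C ⊗ V)).hom = (α_ (𝟙_ C) V (𝟙_ C)).hom ≫ 𝟙_ C ◁ (b.β (𝟙_ C)).hom ≫
      (α_ _ _ _).inv ≫ (λ_ (𝟙_ C)).hom ▷ V := by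
    exact n
  have e3 : 𝟙_ C ◁ (b.β (𝟙_ C)).hom = 𝟙_ C ◁ ((ρ_ V).hom ≫ (λ_ V).inv) := by
    rw [← cancel_epi (α_ (𝟙_ C) V (𝟙_ C)).hom, ← cancel_mono ((α_ (𝟙_ C) (𝟙_ C) V).inv ≫ (λ_ (𝟙_ C)).hom ▷ V)]
    rw [Category.assoc, ← e2]
    monoidal
  exact (whiskerLeft_iff _ _).mp e3

section RightRigid
variable [RightRigidCategory C]

/-- The Drinfeld morphism `u_V : V ⟶ V**` of an object `V` of the Drinfeld center (on underlying
objects): the composite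
`V ⟶ (V* ⊗ V**) ⊗ V ≅ V* ⊗ (V** ⊗ V) ⟶ V* ⊗ (V ⊗ V**) ≅ (V* ⊗ V) ⊗ V** ⟶ V**`
of `coev_{V*}`, the inverse half-braiding `V** ⊗ V ⟶ V ⊗ V**`, and `ev_V`. Here `X* = X✶` is the
dual with `ev : X* ⊗ X ⟶ 1` and `coev : 1 ⟶ X ⊗ X*`. -/
def drinfeld (V : Center C) : V.1 ⟶ V.1✶✶ :=
  (λ_ V.1).inv ≫ η_ V.1✶ V.1✶✶ ▷ V.1 ≫ (α_ _ _ _).hom ≫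
    V.1✶ ◁ (V.2.β V.1✶✶).inv ≫ (α_ _ _ _).inv ≫
    ε_ V.1 V.1✶ ▷ V.1✶✶ ≫ (λ_ V.1✶✶).hom
end RightRigid

variable [RigidCategory C]

/-- The mate `V* ⟶ *V` of the half-braiding with `V*`; it serves to invert the Drinfeld morphism. -/
def mateHom (V : Center C) : V.1✶ ⟶ (⋆V.1) :=
  𝟙 _ ⊗≫ η_ (⋆V.1) V.1 ▷ V.1✶ ⊗≫ (⋆V.1) ◁ ((V.2.β V.1✶).hom ≫ ε_ V.1 V.1✶) ⊗≫ 𝟙 _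

/-- The inverse of `mateHom`. -/
def mateInv (V : Center C) : (⋆V.1) ⟶ V.1✶ :=
  𝟙 _ ⊗≫ (⋆V.1) ◁ η_ V.1 V.1✶ ⊗≫
   ((V.2.β (⋆V.1)).inv ≫ ε_ (⋆V.1) V.1) ▷ V.1✶ ⊗≫ 𝟙 _

theorem mateHom_ev (V : Center C) :
    V.1 ◁ mateHom V ≫ ε_ (⋆V.1) V.1 = (V.2.β V.1✶).hom ≫ ε_ V.1 V.1✶ := by
  calc _ = 𝟙 _ ⊗≫ V.1 ◁ η_ (⋆V.1) V.1 ▷ V.1✶ ⊗≫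
        ((V.1 ⊗ (⋆V.1)) ◁ ((V.2.β V.1✶).hom ≫ ε_ V.1 V.1✶) ≫ ε_ (⋆V.1) V.1 ▷ _) ⊗≫ 𝟙 _ := by
          dsimp only [mateHom]; monoidal
    _ = 𝟙 _ ⊗≫ (V.1 ◁ η_ (⋆V.1) V.1 ⊗≫ ε_ (⋆V.1) V.1 ▷ V.1) ▷ V.1✶ ⊗≫
        ((V.2.β V.1✶).hom ≫ ε_ V.1 V.1✶) := by
          rw [whisker_exchange]; monoidal
    _ = _ := by
          rw [ExactPairing.coevaluation_evaluation'']; monoidal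

theorem mateInv_ev (V : Center C) :
    mateInv V ▷ V.1 ≫ ε_ V.1 V.1✶ = (V.2.β (⋆V.1)).inv ≫ ε_ (⋆V.1) V.1 := by
  calc _ = 𝟙 _ ⊗≫ (⋆V.1) ◁ η_ V.1 V.1✶ ▷ V.1 ⊗≫
        (((V.2.β (⋆V.1)).inv ≫ ε_ (⋆V.1) V.1) ▷ (V.1✶ ⊗ V.1) ≫ _ ◁ ε_ V.1 V.1✶) ⊗≫ 𝟙 _ := by
          dsimp only [mateInv]; monoidal
    _ = 𝟙 _ ⊗≫ (⋆V.1) ◁ (η_ V.1 V.1✶ ▷ V.1 ⊗≫ V.1 ◁ ε_ V.1 V.1✶) ⊗≫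
        ((V.2.β (⋆V.1)).inv ≫ ε_ (⋆V.1) V.1) := by
          rw [← whisker_exchange]; monoidal
    _ = _ := by
          rw [ExactPairing.evaluation_coevaluation'']; monoidal

theorem mateHom_mateInv (V : Center C) : mateHom V ≫ mateInv V = 𝟙 _ := by
  have nat : mateHom V ▷ V.1 ≫ (V.2.β (⋆V.1)).inv = (V.2.β V.1✶).inv ≫ V.1 ◁ mateHom V := by
    rw [Iso.eq_inv_comp, ← Category.assoc, Iso.comp_inv_eq, V.2.naturality]
  calc _ = 𝟙 _ ⊗≫ (mateHom V ▷ (𝟙_ C) ≫ (⋆V.1) ◁ η_ V.1 V.1✶) ⊗≫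
      ((V.2.β (⋆V.1)).inv ≫ ε_ (⋆V.1) V.1) ▷ V.1✶ ⊗≫ 𝟙 _ := by
        dsimp only [mateInv]; monoidal
    _ = 𝟙 _ ⊗≫ V.1✶ ◁ η_ V.1 V.1✶ ⊗≫
      (mateHom V ▷ V.1 ≫ (V.2.β (⋆V.1)).inv ≫ ε_ (⋆V.1) V.1) ▷ V.1✶ ⊗≫ 𝟙 _ := by
        rw [← whisker_exchange]; monoidal
    _ = 𝟙 _ ⊗≫ V.1✶ ◁ η_ V.1 V.1✶ ⊗≫ ε_ V.1 V.1✶ ▷ V.1✶ ⊗≫ 𝟙 _ := by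
        rw [reassoc_of% nat, mateHom_ev, Iso.inv_hom_id_assoc]
    _ = 𝟙 _ ⊗≫ (V.1✶ ◁ η_ V.1 V.1✶ ⊗≫ ε_ V.1 V.1✶ ▷ V.1✶) ⊗≫ 𝟙 _ := by monoidal
    _ = _ := by
        rw [ExactPairing.coevaluation_evaluation'']; monoidal

theorem mateInv_mateHom (V : Center C) : mateInv V ≫ mateHom V = 𝟙 _ := by
  calc _ = 𝟙 _ ⊗≫ ((𝟙_ C) ◁ mateInv V ≫ η_ (⋆V.1) V.1 ▷ V.1✶) ⊗≫
      (⋆V.1) ◁ ((V.2.β V.1✶).hom ≫ ε_ V.1 V.1✶) ⊗≫ 𝟙 _ := by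
        dsimp only [mateHom]; monoidal
    _ = 𝟙 _ ⊗≫ η_ (⋆V.1) V.1 ▷ (⋆V.1) ⊗≫
      (⋆V.1) ◁ (V.1 ◁ mateInv V ≫ (V.2.β V.1✶).hom ≫ ε_ V.1 V.1✶) ⊗≫ 𝟙 _ := by
        rw [whisker_exchange]; monoidal
    _ = 𝟙 _ ⊗≫ (η_ (⋆V.1) V.1 ▷ (⋆V.1) ⊗≫ (⋆V.1) ◁ ε_ (⋆V.1) V.1) ⊗≫ 𝟙 _ := by
        rw [V.2.naturality_assoc, mateInv_ev, Iso.hom_inv_id_assoc]; monoidal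
    _ = _ := by
        rw [ExactPairing.evaluation_coevaluation'']; monoidal

theorem coev_halfBraiding (V : Center C) :
    (λ_ V.1).inv ≫ η_ V.1✶ V.1✶✶ ▷ V.1 ≫ (α_ _ _ _).hom ≫ V.1✶ ◁ (V.2.β V.1✶✶).inv =
      (ρ_ V.1).inv ≫ V.1 ◁ η_ V.1✶ V.1✶✶ ≫ (α_ _ _ _).inv ≫ (V.2.β V.1✶).hom ▷ V.1✶✶ ≫
        (α_ _ _ _).hom := by
  have n := V.2.naturality (η_ V.1✶ V.1✶✶)
  rw [V.2.monoidal, halfBraiding_unit] at n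
  have n' := congrArg (fun f => (ρ_ V.1).inv ≫ f ≫ (α_ _ _ _).hom ≫ V.1✶ ◁ (V.2.β V.1✶✶).inv) n
  simpa [← whiskerLeft_comp_assoc, ← MonoidalCategory.whiskerLeft_comp] using n'.symm

theorem drinfeld_eq (V : Center C) :
    drinfeld V = @rightAdjointMate C _ _ V.1✶ (⋆V.1) _ hasRightDualLeftDual (mateHom V) := by
  have e : drinfeld V = (ρ_ V.1).inv ≫ V.1 ◁ η_ V.1✶ V.1✶✶ ≫ (α_ _ _ _).inv ≫
      ((V.2.β V.1✶).hom ≫ ε_ V.1 V.1✶) ▷ V.1✶✶ ≫ (λ_ _).hom := by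
    have := coev_halfBraiding V =≫ ((α_ _ _ _).inv ≫ ε_ V.1 V.1✶ ▷ V.1✶✶ ≫ (λ_ V.1✶✶).hom)
    simp only [Category.assoc] at this
    rw [drinfeld, this]
    simp
  rw [e, ← mateHom_ev]
  simp only [rightAdjointMate, comp_whiskerRight, whisker_assoc, Category.assoc,
    Iso.inv_hom_id_assoc]
  rfl

instance drinfeld_isIso (V : Center C) : IsIso (drinfeld V) := by
  refine ⟨@rightAdjointMate C _ _ (⋆V.1) V.1✶ hasRightDualLeftDual _ (mateInv V), ?_, ?_⟩
  · rw [drinfeld_eq, ← @comp_rightAdjointMate, mateInv_mateHom, @rightAdjointMate_id]; rfl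
  · rw [drinfeld_eq, ← @comp_rightAdjointMate, mateHom_mateInv, @rightAdjointMate_id]
end


section RawAction
open MonoidalLeftAction
universe v₁ u₁ v₃ u₃
variable {C : Type u₁} [Category.{v₁} C] [MonoidalCategory C]
variable {M : Type u₃} [Category.{v₃} M] [MonoidalLeftAction C M]

theorem associator_act (X Y Z : C) (m : M) :
    (α_ X Y Z).hom ⊵ₗ m = (αₗ (X ⊗ Y) Z m).hom ≫ (αₗ X Y (Z ⊙ₗ m)).hom ≫
      X ⊴ₗ (αₗ Y Z m).inv ≫ (αₗ X (Y ⊗ Z) m).inv := by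
  rw [← associator_actionHom_assoc]; simp

theorem associator_inv_act (X Y Z : C) (m : M) :
    (α_ X Y Z).inv ⊵ₗ m = (αₗ X (Y ⊗ Z) m).hom ≫ X ⊴ₗ (αₗ Y Z m).hom ≫
      (αₗ X Y (Z ⊙ₗ m)).inv ≫ (αₗ (X ⊗ Y) Z m).inv := by
  rw [← cancel_epi ((α_ X Y Z).hom ⊵ₗ m), ← comp_actionHomLeft, associator_actionHom_assoc]; simp

theorem leftUnitor_inv_act (X : C) (m : M) :
    (λ_ X).inv ⊵ₗ m = (λₗ[C] (X ⊙ₗ m)).inv ≫ (αₗ (𝟙_ C) X m).inv := by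
  rw [← cancel_epi ((λ_ X).hom ⊵ₗ m), ← comp_actionHomLeft]; simp

theorem rightUnitor_inv_act (X : C) (m : M) :
    (ρ_ X).inv ⊵ₗ m = X ⊴ₗ (λₗ[C] m).inv ≫ (αₗ X (𝟙_ C) m).inv := by
  rw [← cancel_epi ((ρ_ X).hom ⊵ₗ m), ← comp_actionHomLeft]; simp


theorem act_unit_nat (X Y : C) [ExactPairing X Y] {m m' : M} (f : m ⟶ m') :
    f ≫ (λₗ[C] m').inv ≫ η_ X Y ⊵ₗ m' ≫ (αₗ X Y m').hom =
      ((λₗ[C] m).inv ≫ η_ X Y ⊵ₗ m ≫ (αₗ X Y m).hom) ≫ X ⊴ₗ Y ⊴ₗ f := by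
  have h := action_exchange (η_ X Y) f
  simp only [unit_actionHomRight, tensor_actionHomRight, Category.assoc] at h
  rw [← cancel_epi (λₗ[C] m).hom, reassoc_of% h]
  simp

theorem act_counit_nat (X Y : C) [ExactPairing X Y] {m m' : M} (f : m ⟶ m') :
    Y ⊴ₗ X ⊴ₗ f ≫ (αₗ Y X m').inv ≫ ε_ X Y ⊵ₗ m' ≫ (λₗ[C] m').hom =
      ((αₗ Y X m).inv ≫ ε_ X Y ⊵ₗ m ≫ (λₗ[C] m).hom) ≫ f := by
  have h := action_exchange (ε_ X Y) f
  simp only [unit_actionHomRight, tensor_actionHomRight, Category.assoc] at h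
  rw [← cancel_epi (αₗ Y X m).hom, reassoc_of% h]
  simp

theorem act_left_triangle (X Y : C) [ExactPairing X Y] (m : M) :
    Y ⊴ₗ ((λₗ[C] m).inv ≫ η_ X Y ⊵ₗ m ≫ (αₗ X Y m).hom) ≫
      (αₗ Y X (Y ⊙ₗ m)).inv ≫ ε_ X Y ⊵ₗ (Y ⊙ₗ m) ≫ (λₗ[C] (Y ⊙ₗ m)).hom = 𝟙 _ := by
  have h := congrArg (fun f => f ⊵ₗ m) (ExactPairing.coevaluation_evaluation X Y)
  simp only [comp_actionHomLeft, whiskerLeft_actionHomLeft, whiskerRight_actionHomLeft,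
    associator_inv_act, rightUnitor_actionHom, leftUnitor_inv_act, Category.assoc,
    Iso.inv_hom_id_assoc, Iso.cancel_iso_hom_left] at h
  rw [← cancel_mono (λₗ[C] (Y ⊙ₗ m)).inv, ← cancel_mono (αₗ (𝟙_ C) Y m).inv]
  simp only [actionHomRight_comp, Category.assoc, Iso.hom_inv_id_assoc, h]
  simp

theorem act_right_triangle (X Y : C) [ExactPairing X Y] (m : M) :
    ((λₗ[C] (X ⊙ₗ m)).inv ≫ η_ X Y ⊵ₗ (X ⊙ₗ m) ≫ (αₗ X Y (X ⊙ₗ m)).hom) ≫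
      X ⊴ₗ ((αₗ Y X m).inv ≫ ε_ X Y ⊵ₗ m ≫ (λₗ[C] m).hom) = 𝟙 _ := by
  have h := congrArg (fun f => f ⊵ₗ m) (ExactPairing.evaluation_coevaluation X Y)
  simp only [comp_actionHomLeft, whiskerLeft_actionHomLeft, whiskerRight_actionHomLeft,
    associator_act, leftUnitor_actionHom, rightUnitor_inv_act, Category.assoc,
    Iso.inv_hom_id_assoc, Iso.cancel_iso_hom_left] at h
  rw [← cancel_epi (λₗ[C] (X ⊙ₗ m)).hom, ← cancel_mono (X ⊴ₗ (λₗ[C] m).inv),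
    ← cancel_mono (αₗ X (𝟙_ C) m).inv]
  have e : X ⊴ₗ (λₗ[C] m).hom ≫ X ⊴ₗ (λₗ[C] m).inv = 𝟙 (X ⊙ₗ (𝟙_ C) ⊙ₗ m) := by simp
  simp only [actionHomRight_comp, Category.assoc, Iso.hom_inv_id_assoc, reassoc_of% e, h,
    Category.id_comp]

section HalfBraiding
variable {V : C} (b : HalfBraiding V)

theorem halfBraiding_inv_nat {X Y : C} (f : X ⟶ Y) :
    f ▷ V ≫ (b.β Y).inv = (b.β X).inv ≫ V ◁ f := by
  rw [Iso.eq_inv_comp, ← Category.assoc, Iso.comp_inv_eq, b.naturality]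

theorem halfBraiding_inv_tensor (X Y : C) :
    (b.β (X ⊗ Y)).inv = (α_ X Y V).hom ≫ X ◁ (b.β Y).inv ≫ (α_ X V Y).inv ≫
        (b.β X).inv ▷ Y ≫ (α_ V X Y).hom := by
  rw [← cancel_epi (b.β (X ⊗ Y)).hom, Iso.hom_inv_id, b.monoidal]
  simp only [Category.assoc, Iso.inv_hom_id_assoc, whiskerLeft_hom_inv_assoc, Iso.hom_inv_id_assoc,
    hom_inv_whiskerRight_assoc, Iso.inv_hom_id]

theorem halfBraiding_inv_unit : (b.β (𝟙_ C)).inv = (λ_ V).hom ≫ (ρ_ V).inv := by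
  rw [← cancel_epi (b.β (𝟙_ C)).hom, Iso.hom_inv_id, halfBraiding_unit]; simp

/-- The morphism `X ⊙ (V ⊙ m) ⟶ V ⊙ (X ⊙ m)` given by the inverse half-braiding of `V`. -/
def actMu (X : C) (m : M) : X ⊙ₗ V ⊙ₗ m ⟶ V ⊙ₗ X ⊙ₗ m :=
  (αₗ X V m).inv ≫ (b.β X).inv ⊵ₗ m ≫ (αₗ V X m).hom

/-- The inverse of `actMu`, given by the half-braiding of `V`. -/
def actDelta (X : C) (m : M) : V ⊙ₗ X ⊙ₗ m ⟶ X ⊙ₗ V ⊙ₗ m :=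
  (αₗ V X m).inv ≫ (b.β X).hom ⊵ₗ m ≫ (αₗ X V m).hom

theorem actMu_actDelta (X : C) (m : M) : actMu b X m ≫ actDelta b X m = 𝟙 _ := by
  simp [actMu, actDelta, ← comp_actionHomLeft_assoc]

theorem actDelta_actMu (X : C) (m : M) : actDelta b X m ≫ actMu b X m = 𝟙 _ := by
  simp [actMu, actDelta, ← comp_actionHomLeft_assoc]

theorem actMu_nat_left {X Y : C} (f : X ⟶ Y) (m : M) :
    f ⊵ₗ (V ⊙ₗ m) ≫ actMu b Y m = actMu b X m ≫ V ⊴ₗ f ⊵ₗ m := by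
  have h := congrArg (fun f => f ⊵ₗ m) (halfBraiding_inv_nat b f)
  simp only [comp_actionHomLeft, whiskerLeft_actionHomLeft, whiskerRight_actionHomLeft,
    Category.assoc] at h
  rw [← cancel_epi (αₗ X V m).hom]
  simp only [actMu, Category.assoc, reassoc_of% h, Iso.hom_inv_id_assoc, Iso.inv_hom_id,
    Category.comp_id]

theorem actMu_nat_right (X : C) {m m' : M} (f : m ⟶ m') :
    X ⊴ₗ V ⊴ₗ f ≫ actMu b X m' = actMu b X m ≫ V ⊴ₗ X ⊴ₗ f := by
  have h := action_exchange (b.β X).inv f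
  simp only [tensor_actionHomRight, Category.assoc] at h
  rw [← cancel_epi (αₗ X V m).hom]
  simp only [actMu, Category.assoc, reassoc_of% h, Iso.hom_inv_id_assoc, Iso.inv_hom_id,
    Category.comp_id]

theorem actMu_assoc (X Y : C) (m : M) :
    actMu b (X ⊗ Y) m ≫ V ⊴ₗ (αₗ X Y m).hom =
      (αₗ X Y (V ⊙ₗ m)).hom ≫ X ⊴ₗ actMu b Y m ≫ actMu b X (Y ⊙ₗ m) := by
  simp only [actMu, halfBraiding_inv_tensor, comp_actionHomLeft, whiskerLeft_actionHomLeft,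
    whiskerRight_actionHomLeft, associator_act, associator_inv_act, Category.assoc,
    actionHomRight_comp]
  simp

theorem actMu_unit (m : M) :
    actMu b (𝟙_ C) m ≫ V ⊴ₗ (λₗ[C] m).hom = (λₗ[C] (V ⊙ₗ m)).hom := by
  simp only [actMu, halfBraiding_inv_unit, comp_actionHomLeft, rightUnitor_inv_act,
    leftUnitor_actionHom, Category.assoc]
  simp

theorem actDelta_nat_left {X Y : C} (f : X ⟶ Y) (m : M) :
    V ⊴ₗ f ⊵ₗ m ≫ actDelta b Y m = actDelta b X m ≫ f ⊵ₗ (V ⊙ₗ m) := by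
  have h := congrArg (fun f => f ⊵ₗ m) (b.naturality f)
  simp only [comp_actionHomLeft, whiskerLeft_actionHomLeft, whiskerRight_actionHomLeft,
    Category.assoc] at h
  rw [← cancel_epi (αₗ V X m).hom]
  simp only [actDelta, Category.assoc, reassoc_of% h, Iso.hom_inv_id_assoc, Iso.inv_hom_id,
    Category.comp_id]

theorem actDelta_nat_right (X : C) {m m' : M} (f : m ⟶ m') :
    V ⊴ₗ X ⊴ₗ f ≫ actDelta b X m' = actDelta b X m ≫ X ⊴ₗ V ⊴ₗ f := by
  have h := action_exchange (b.β X).hom f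
  simp only [tensor_actionHomRight, Category.assoc] at h
  rw [← cancel_epi (αₗ V X m).hom]
  simp only [actDelta, Category.assoc, reassoc_of% h, Iso.hom_inv_id_assoc, Iso.inv_hom_id,
    Category.comp_id]

theorem actDelta_assoc (X Y : C) (m : M) :
    actDelta b (X ⊗ Y) m ≫ (αₗ X Y (V ⊙ₗ m)).hom =
      V ⊴ₗ (αₗ X Y m).hom ≫ actDelta b X (Y ⊙ₗ m) ≫ X ⊴ₗ actDelta b Y m := by
  simp only [actDelta, b.monoidal, comp_actionHomLeft, whiskerLeft_actionHomLeft,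
    whiskerRight_actionHomLeft, associator_act, associator_inv_act, Category.assoc,
    actionHomRight_comp]
  simp

theorem actDelta_unit (m : M) :
    (λₗ[C] (V ⊙ₗ m)).inv = V ⊴ₗ (λₗ[C] m).inv ≫ actDelta b (𝟙_ C) m := by
  simp only [actDelta, halfBraiding_unit, comp_actionHomLeft, leftUnitor_inv_act,
    rightUnitor_actionHom, Category.assoc]
  simp

end HalfBraiding

theorem actMu_hom {V W : Center C} (f : V ⟶ W) (X : C) (m : M) :
    X ⊴ₗ f.f ⊵ₗ m ≫ actMu W.2 X m = actMu V.2 X m ≫ f.f ⊵ₗ (X ⊙ₗ m) := by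
  have h : X ◁ f.f ≫ (W.2.β X).inv = (V.2.β X).inv ≫ f.f ▷ X := by
    rw [Iso.eq_inv_comp, ← Category.assoc, Iso.comp_inv_eq, f.comm]
  have h := congrArg (fun f => f ⊵ₗ m) h
  simp only [comp_actionHomLeft, whiskerLeft_actionHomLeft, whiskerRight_actionHomLeft,
    Category.assoc] at h
  rw [← cancel_epi (αₗ X V.1 m).hom]
  simp only [actMu, Category.assoc, reassoc_of% h, Iso.hom_inv_id_assoc, Iso.inv_hom_id,
    Category.comp_id]

end RawAction

section Dual
open MonoidalLeftAction Functor.LaxLeftLinear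
universe v₁ u₁ v₃ u₃
variable (C : Type u₁) [Category.{v₁} C] [MonoidalCategory C]
variable (M : Type u₃) [Category.{v₃} M] [Abelian M] [Linear ℂ M] [MonoidalLeftAction C M]

/-- Objects of the dual category of `C` with respect to the left `C`-module category `M`:
`ℂ`-linear right exact endofunctors `F` of `M`, with a `C`-module structure, that is, natural
isomorphisms `X ⊙ F m ≅ F (X ⊙ m)` (denoted `μₗ`) compatible with the associativity and unit
constraints of the action. -/
structure ModuleEnd where
  functor : M ⥤ M
  [additive : functor.Additive]
  [linear : functor.Linear ℂ]
  [rightExact : PreservesFiniteColimits functor]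
  [leftLinear : functor.LeftLinear C]

attribute [instance] ModuleEnd.additive ModuleEnd.linear ModuleEnd.rightExact ModuleEnd.leftLinear

namespace ModuleEnd
variable {C M}

/-- Morphisms of `C`-module functors: natural transformations compatible with the module
structures. -/
@[ext]
structure Hom (F G : ModuleEnd C M) where
  nat : F.functor ⟶ G.functor
  comm : ∀ (X : C) (m : M),
    X ⊴ₗ nat.app m ≫ μₗ G.functor X m = μₗ F.functor X m ≫ nat.app (X ⊙ₗ m)

instance : Category (ModuleEnd C M) where
  Hom F G := Hom F G
  id F := ⟨𝟙 _, by simp⟩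
  comp f g := ⟨f.nat ≫ g.nat, fun X m => by
    simp [g.comm, reassoc_of% f.comm]⟩

end ModuleEnd

/-- The action functor `C × M ⥤ M` is `ℂ`-bilinear on morphisms. (For a rigid `C` acting on `M`,
each `X ⊙ -` is exact, and for semisimple `C` the functors `- ⊙ m` are then exact as well.) -/
class BilinearAction [Preadditive C] [Linear ℂ C] : Prop where
  add_left : ∀ {X Y : C} (f g : X ⟶ Y) (m : M), (f + g) ⊵ₗ m = f ⊵ₗ m + g ⊵ₗ m
  smul_left : ∀ {X Y : C} (c : ℂ) (f : X ⟶ Y) (m : M), (c • f) ⊵ₗ m = c • f ⊵ₗ m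
  add_right : ∀ (X : C) {m m' : M} (f g : m ⟶ m'), X ⊴ₗ (f + g) = X ⊴ₗ f + X ⊴ₗ g
  smul_right : ∀ (X : C) {m m' : M} (c : ℂ) (f : m ⟶ m'), X ⊴ₗ (c • f) = c • X ⊴ₗ f

section Act
variable {C}

/-- The endofunctor `X ⊙ -` of `M`. -/
def actFunctor (X : C) : M ⥤ M where
  obj m := X ⊙ₗ m
  map f := X ⊴ₗ f

/-- If `Y` is dual to `X`, then `Y ⊙ -` is left adjoint to `X ⊙ -`. -/
def actAdjunction (X Y : C) [ExactPairing X Y] : actFunctor M Y ⊣ actFunctor M X where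
  unit := { app := fun m => (λₗ[C] m).inv ≫ η_ X Y ⊵ₗ m ≫ (αₗ X Y m).hom
            naturality := fun _ _ f => act_unit_nat X Y f }
  counit := { app := fun m => (αₗ Y X m).inv ≫ ε_ X Y ⊵ₗ m ≫ (λₗ[C] m).hom
              naturality := fun _ _ f => act_counit_nat X Y f }
  left_triangle_components m := act_left_triangle X Y m
  right_triangle_components m := act_right_triangle X Y m

/-- The `C`-module structure on `V ⊙ -` given by the inverse half-braiding,
`X ⊙ V ⊙ m ⟶ V ⊙ X ⊙ m`. -/
@[reducible]
def actLeftLinear {V : C} (b : HalfBraiding V) : (actFunctor M V).LeftLinear C where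
  μₗ X m := actMu b X m
  δₗ X m := actDelta b X m
  μₗ_naturality_left f m := actMu_nat_left b f m
  μₗ_naturality_right X _ _ f := actMu_nat_right b X f
  μₗ_associativity X Y m := actMu_assoc b X Y m
  μₗ_unitality m := (actMu_unit b m).symm
  δₗ_naturality_left f m := actDelta_nat_left b f m
  δₗ_naturality_right X _ _ f := actDelta_nat_right b X f
  δₗ_associativity X Y m := actDelta_assoc b X Y m
  δₗ_unitality_inv m := actDelta_unit b m
  μₗ_comp_δₗ X m := actMu_actDelta b X m
  δₗ_comp_μₗ X m := actDelta_actMu b X m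

end Act

variable [Preadditive C] [Linear ℂ C] [BilinearAction C M]

instance actFunctor_additive (X : C) : (actFunctor M X).Additive :=
  ⟨fun {_ _ f g} => BilinearAction.add_right X f g⟩

instance actFunctor_linear (X : C) : (actFunctor M X).Linear ℂ :=
  ⟨fun f c => BilinearAction.smul_right X c f⟩

variable [RigidCategory C]

instance actFunctor_rightExact (X : C) : PreservesFiniteColimits (actFunctor M X) :=
  have : PreservesColimitsOfSize.{0, 0} (actFunctor M X) :=
    (actAdjunction M (⋆X) X).leftAdjoint_preservesColimits
  inferInstance

/-- The functor from the Drinfeld center of `C` to the dual category, `(V, σ) ↦ (V ⊙ -, σ⁻¹ ⊙ id)`;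
it is the composite of the equivalence of `Z(C)` with the center of the dual category and the functor
forgetting the half-braiding there. -/
def centralAction : Center C ⥤ ModuleEnd C M where
  obj V := { functor := actFunctor M V.1, leftLinear := actLeftLinear M V.2 }
  map f :=
    { nat := { app := fun m => f.f ⊵ₗ m
               naturality := fun _ _ g => action_exchange f.f g }
      comm := fun X m => actMu_hom f X m }
  map_id V := ModuleEnd.Hom.ext (NatTrans.ext (funext fun m => id_actionHomLeft V.1 m))
  map_comp f g :=
    ModuleEnd.Hom.ext (NatTrans.ext (funext fun m => comp_actionHomLeft f.f g.f m))

end Dual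

section Restrict
open MonoidalLeftAction Functor.LaxLeftLinear Functor.LaxMonoidal Functor.OplaxMonoidal
universe v₁ u₁ v₂ u₂ v₃ u₃
variable {C : Type u₁} [Category.{v₁} C] [MonoidalCategory C]
variable {D : Type u₂} [Category.{v₂} D] [MonoidalCategory D] (Φ : C ⥤ D) [Φ.Monoidal]

section Raw
variable {M : Type u₃} [Category.{v₃} M] [MonoidalLeftAction D M]

/-- Associativity constraint of the action `X ⊙ m = Φ X ⊙ m`. -/
def resAssoc (X Y : C) (m : M) : Φ.obj (X ⊗ Y) ⊙ₗ m ≅ Φ.obj X ⊙ₗ Φ.obj Y ⊙ₗ m where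
  hom := δ Φ X Y ⊵ₗ m ≫ (αₗ (Φ.obj X) (Φ.obj Y) m).hom
  inv := (αₗ (Φ.obj X) (Φ.obj Y) m).inv ≫ μ Φ X Y ⊵ₗ m
  hom_inv_id := by simp [← comp_actionHomLeft]
  inv_hom_id := by simp [← comp_actionHomLeft_assoc]

/-- Unit constraint of the action `X ⊙ m = Φ X ⊙ m`. -/
def resUnit (m : M) : Φ.obj (𝟙_ C) ⊙ₗ m ≅ m where
  hom := η Φ ⊵ₗ m ≫ (λₗ[D] m).hom
  inv := (λₗ[D] m).inv ≫ ε Φ ⊵ₗ m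
  hom_inv_id := by simp [← comp_actionHomLeft]
  inv_hom_id := by simp [← comp_actionHomLeft_assoc]

theorem resAssoc_nat {X X' Y Y' : C} {m m' : M} (f : X ⟶ X') (g : Y ⟶ Y') (h : m ⟶ m') :
    (Φ.map (f ⊗ₘ g) ⊙ₗₘ h) ≫ (resAssoc Φ X' Y' m').hom =
      (resAssoc Φ X Y m).hom ≫ (Φ.map f ⊙ₗₘ (Φ.map g ⊙ₗₘ h)) := by
  have h1 := congrArg (fun k => k ⊙ₗₘ h) (δ_natural Φ f g)
  have h2 := actionAssocIso_hom_naturality (Φ.map f) (Φ.map g) h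
  have e1 : (Φ.map (f ⊗ₘ g) ⊙ₗₘ h) ≫ δ Φ X' Y' ⊵ₗ m' = (Φ.map (f ⊗ₘ g) ≫ δ Φ X' Y') ⊙ₗₘ h := by
    rw [← actionHom_id, ← actionHom_comp, Category.comp_id]
  have e2 : δ Φ X Y ⊵ₗ m ≫ ((Φ.map f ⊗ₘ Φ.map g) ⊙ₗₘ h) =
      (δ Φ X Y ≫ (Φ.map f ⊗ₘ Φ.map g)) ⊙ₗₘ h := by
    rw [← actionHom_id, ← actionHom_comp, Category.id_comp]
  simp only [resAssoc, Category.assoc]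
  rw [reassoc_of% e1, ← h2, reassoc_of% e2, δ_natural]

theorem resUnit_nat {m m' : M} (f : m ⟶ m') :
    Φ.obj (𝟙_ C) ⊴ₗ f ≫ (resUnit Φ m').hom = (resUnit Φ m).hom ≫ f := by
  have h := action_exchange (η Φ) f
  simp only [resUnit, Category.assoc]
  rw [reassoc_of% h, unit_actionHomRight]
  simp

theorem res_whiskerLeft (X : C) {Y Z : C} (f : Y ⟶ Z) (m : M) :
    Φ.map (X ◁ f) ⊵ₗ m =
      (resAssoc Φ X Y m).hom ≫ Φ.obj X ⊴ₗ Φ.map f ⊵ₗ m ≫ (resAssoc Φ X Z m).inv := by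
  rw [Functor.Monoidal.map_whiskerLeft]
  simp only [resAssoc, comp_actionHomLeft, whiskerLeft_actionHomLeft, Category.assoc]

theorem res_whiskerRight {X Y : C} (Z : C) (f : X ⟶ Y) (m : M) :
    Φ.map (f ▷ Z) ⊵ₗ m =
      (resAssoc Φ X Z m).hom ≫ Φ.map f ⊵ₗ (Φ.obj Z ⊙ₗ m) ≫ (resAssoc Φ Y Z m).inv := by
  rw [Functor.Monoidal.map_whiskerRight]
  simp only [resAssoc, comp_actionHomLeft, whiskerRight_actionHomLeft, Category.assoc]

theorem res_associator (X Y Z : C) (m : M) :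
    Φ.map (α_ X Y Z).hom ⊵ₗ m ≫ (resAssoc Φ X (Y ⊗ Z) m).hom ≫
        Φ.obj X ⊴ₗ (resAssoc Φ Y Z m).hom =
      (resAssoc Φ (X ⊗ Y) Z m).hom ≫ (resAssoc Φ X Y (Φ.obj Z ⊙ₗ m)).hom := by
  rw [Functor.Monoidal.map_associator]
  simp only [resAssoc, comp_actionHomLeft, whiskerRight_actionHomLeft, whiskerLeft_actionHomLeft,
    Category.assoc, associator_act, actionHomRight_comp]
  have e1 : μ Φ X (Y ⊗ Z) ⊵ₗ m ≫ δ Φ X (Y ⊗ Z) ⊵ₗ m = 𝟙 _ := by simp [← comp_actionHomLeft]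
  have e2 : Φ.obj X ⊴ₗ μ Φ Y Z ⊵ₗ m ≫ Φ.obj X ⊴ₗ δ Φ Y Z ⊵ₗ m = 𝟙 _ := by
    rw [← actionHomRight_comp, ← comp_actionHomLeft]; simp
  have e3 : Φ.obj X ⊴ₗ (αₗ (Φ.obj Y) (Φ.obj Z) m).inv ≫
      Φ.obj X ⊴ₗ (αₗ (Φ.obj Y) (Φ.obj Z) m).hom = 𝟙 _ := by simp
  simp only [Iso.inv_hom_id_assoc, reassoc_of% e1, reassoc_of% e2, e3, Category.comp_id]

theorem res_leftUnitor (X : C) (m : M) :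
    Φ.map (λ_ X).hom ⊵ₗ m = (resAssoc Φ (𝟙_ C) X m).hom ≫ (resUnit Φ (Φ.obj X ⊙ₗ m)).hom := by
  rw [Functor.Monoidal.map_leftUnitor]
  simp only [resAssoc, resUnit, comp_actionHomLeft, whiskerRight_actionHomLeft,
    leftUnitor_actionHom, Category.assoc, Iso.inv_hom_id_assoc]

theorem res_rightUnitor (X : C) (m : M) :
    Φ.map (ρ_ X).hom ⊵ₗ m = (resAssoc Φ X (𝟙_ C) m).hom ≫ Φ.obj X ⊴ₗ (resUnit Φ m).hom := by
  rw [Functor.Monoidal.map_rightUnitor]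
  simp only [resAssoc, resUnit, comp_actionHomLeft, whiskerLeft_actionHomLeft,
    rightUnitor_actionHom, Category.assoc, Iso.inv_hom_id_assoc, actionHomRight_comp]

end Raw

variable (M : Type u₃) [Category.{v₃} M] [MonoidalLeftAction D M]

/-- A left `D`-module category `M` as a left `C`-module category, via a monoidal functor
`Φ : C ⥤ D`, with `X` acting as `Φ X`. -/
@[reducible]
def restrictAction : MonoidalLeftAction C M where
  actionObj X m := Φ.obj X ⊙ₗ m
  actionHomLeft f m := Φ.map f ⊵ₗ m
  actionHomRight X _ _ f := Φ.obj X ⊴ₗ f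
  actionHom f g := Φ.map f ⊙ₗₘ g
  actionAssocIso X Y m := resAssoc Φ X Y m
  actionUnitIso m := resUnit Φ m
  actionHom_def f g := actionHom_def (Φ.map f) g
  actionHomRight_id X m := actionHomRight_id (Φ.obj X) m
  id_actionHomLeft X m := by rw [Φ.map_id]; exact id_actionHomLeft (Φ.obj X) m
  actionHom_comp f f' g g' := by rw [Φ.map_comp]; exact actionHom_comp _ _ _ _
  actionAssocIso_hom_naturality f g h := resAssoc_nat Φ f g h
  actionUnitIso_hom_naturality f := (resUnit_nat Φ f).symm
  whiskerLeft_actionHomLeft X _ _ f m := res_whiskerLeft Φ X f m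
  whiskerRight_actionHomLeft Z f m := res_whiskerRight Φ Z f m
  associator_actionHom X Y Z m := res_associator Φ X Y Z m
  leftUnitor_actionHom X m := res_leftUnitor Φ X m
  rightUnitor_actionHom X m := res_rightUnitor Φ X m

end Restrict

section RestrictLinear
open MonoidalLeftAction Functor.LaxLeftLinear Functor.OplaxLeftLinear
universe v₁ u₁ v₂ u₂ v₃ u₃
variable {C : Type u₁} [Category.{v₁} C] [MonoidalCategory C]
variable {D : Type u₂} [Category.{v₂} D] [MonoidalCategory D] (Φ : C ⥤ D) [Φ.Monoidal]
variable {M : Type u₃} [Category.{v₃} M] [MonoidalLeftAction D M]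
variable (F : M ⥤ M) [F.LeftLinear D]

theorem res_mu_assoc (X Y : C) (m : M) :
    μₗ F (Φ.obj (X ⊗ Y)) m ≫ F.map (resAssoc Φ X Y m).hom =
      (resAssoc Φ X Y (F.obj m)).hom ≫ Φ.obj X ⊴ₗ μₗ F (Φ.obj Y) m ≫
        μₗ F (Φ.obj X) (Φ.obj Y ⊙ₗ m) := by
  simp only [resAssoc, F.map_comp, Category.assoc]
  rw [← μₗ_naturality_left_assoc, μₗ_associativity]

theorem res_mu_unit (m : M) :
    (resUnit Φ (F.obj m)).hom = μₗ F (Φ.obj (𝟙_ C)) m ≫ F.map (resUnit Φ m).hom := by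
  simp only [resUnit, F.map_comp]
  rw [← μₗ_naturality_left_assoc, μₗ_unitality]

theorem res_delta_assoc (X Y : C) (m : M) :
    δₗ F (Φ.obj (X ⊗ Y)) m ≫ (resAssoc Φ X Y (F.obj m)).hom =
      F.map (resAssoc Φ X Y m).hom ≫ δₗ F (Φ.obj X) (Φ.obj Y ⊙ₗ m) ≫
        Φ.obj X ⊴ₗ δₗ F (Φ.obj Y) m := by
  simp only [resAssoc, F.map_comp, Category.assoc]
  rw [← δₗ_naturality_left_assoc, δₗ_associativity]

theorem res_delta_unit (m : M) :
    (resUnit Φ (F.obj m)).inv = F.map (resUnit Φ m).inv ≫ δₗ F (Φ.obj (𝟙_ C)) m := by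
  simp only [resUnit, F.map_comp, Category.assoc]
  rw [δₗ_naturality_left, δₗ_unitality_inv, Category.assoc]

/-- A `D`-module structure `s` on a functor gives the `C`-module structure `s_{Φ X, m}`. -/
@[reducible]
def restrictLeftLinear :
    letI : MonoidalLeftAction C M := restrictAction Φ M
    F.LeftLinear C :=
  letI : MonoidalLeftAction C M := restrictAction Φ M
  { μₗ := fun X m => μₗ F (Φ.obj X) m
    δₗ := fun X m => δₗ F (Φ.obj X) m
    μₗ_naturality_left := fun f m => μₗ_naturality_left F (Φ.map f) m
    μₗ_naturality_right := fun X _ _ f => μₗ_naturality_right F (Φ.obj X) f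
    μₗ_associativity := fun X Y m => res_mu_assoc Φ F X Y m
    μₗ_unitality := fun m => res_mu_unit Φ F m
    δₗ_naturality_left := fun f m => δₗ_naturality_left F (Φ.map f) m
    δₗ_naturality_right := fun X _ _ f => δₗ_naturality_right F (Φ.obj X) f
    δₗ_associativity := fun X Y m => res_delta_assoc Φ F X Y m
    δₗ_unitality_inv := fun m => res_delta_unit Φ F m
    μₗ_comp_δₗ := fun X m => Functor.LeftLinear.μₗ_comp_δₗ F (Φ.obj X) m
    δₗ_comp_μₗ := fun X m => Functor.LeftLinear.δₗ_comp_μₗ F (Φ.obj X) m }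

end RestrictLinear

section RestrictedDual
open MonoidalLeftAction Functor.LaxLeftLinear
universe v₁ u₁ v₂ u₂ v₃ u₃
variable {C : Type u₁} [Category.{v₁} C] [MonoidalCategory C] [Preadditive C] [Linear ℂ C]
variable {D : Type u₂} [Category.{v₂} D] [MonoidalCategory D] [Preadditive D] [Linear ℂ D]
variable (Φ : C ⥤ D) [Φ.Monoidal]
variable (M : Type u₃) [Category.{v₃} M] [Abelian M] [Linear ℂ M] [MonoidalLeftAction D M]

instance restrictAction_bilinear [Φ.Additive] [Φ.Linear ℂ] [BilinearAction D M] :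
    @BilinearAction C _ _ M _ _ _ (restrictAction Φ M) _ _ :=
  letI := restrictAction Φ M
  { add_left := fun f g m => by
      change Φ.map (f + g) ⊵ₗ m = Φ.map f ⊵ₗ m + Φ.map g ⊵ₗ m
      rw [Φ.map_add, BilinearAction.add_left]
    smul_left := fun c f m => by
      change Φ.map (c • f) ⊵ₗ m = c • Φ.map f ⊵ₗ m
      rw [Φ.map_smul, BilinearAction.smul_left]
    add_right := fun X _ _ f g => BilinearAction.add_right (Φ.obj X) f g
    smul_right := fun X _ _ c f => BilinearAction.smul_right (Φ.obj X) c f }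

/-- The functor `Φ*` from the `D`-module endofunctors to the `C`-module endofunctors of `M`, given by
`(F, s) ↦ (F, s_{Φ(-), -})`. -/
def dualFunctor :
    letI : MonoidalLeftAction C M := restrictAction Φ M
    ModuleEnd D M ⥤ ModuleEnd C M :=
  letI : MonoidalLeftAction C M := restrictAction Φ M
  { obj := fun F => { functor := F.functor, leftLinear := restrictLeftLinear Φ F.functor }
    map := fun f => { nat := f.nat, comm := fun X m => f.comm (Φ.obj X) m } }

end RestrictedDual

section Pivotal
variable (C : Type u) [Category.{v} C] [MonoidalCategory C] [RigidCategory C]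

/-- The canonical isomorphism `(X ⊗ Y)** ⟶ X** ⊗ Y**`. -/
def doubleDualTensor {C : Type u} [Category.{v} C] [MonoidalCategory C] [RigidCategory C]
    (X Y : C) : (X ⊗ Y)✶✶ ⟶ X✶✶ ⊗ Y✶✶ :=
  rightAdjointMate (rightDualTensorIso X Y).inv ≫ (rightDualTensorIso Y✶ X✶).hom

/-- A pivotal structure: a monoidal natural isomorphism `X ≅ X**`. (Compatibility with the unit
object follows from compatibility with tensor products, as all components are invertible.) -/
structure PivotalStructure where
  iso (X : C) : X ≅ X✶✶
  naturality {X Y : C} (f : X ⟶ Y) :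
    f ≫ (iso Y).hom = (iso X).hom ≫ rightAdjointMate (rightAdjointMate f)
  tensor (X Y : C) :
    (iso (X ⊗ Y)).hom ≫ doubleDualTensor X Y = (iso X).hom ⊗ₘ (iso Y).hom

end Pivotal

section Linear
attribute [local instance] Abelian.hasFiniteBiproducts
variable {C : Type u} [Category.{v} C] [Abelian C] [Linear ℂ C]

variable (C) in
/-- A finite semisimple `ℂ`-linear abelian category: finite-dimensional hom spaces, every object a
finite direct sum of simple objects, finitely many isomorphism classes of simple objects. -/
class IsFiniteSemisimple : Prop where
  finiteDimensional (X Y : C) : FiniteDimensional ℂ (X ⟶ Y)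
  semisimple (X : C) : ∃ (n : ℕ) (S : Fin n → C), (∀ i, Simple (S i)) ∧ Nonempty (X ≅ ⨁ S)
  finite : Finite {c : Quotient (isIsomorphicSetoid C) // ∃ S : C, Simple S ∧ ⟦S⟧ = c}

attribute [instance] IsFiniteSemisimple.finiteDimensional

variable [MonoidalCategory C] [MonoidalPreadditive C] [MonoidalLinear ℂ C] [RigidCategory C]

variable (C) in
/-- A fusion category over `ℂ`: a finite semisimple `ℂ`-linear rigid monoidal category (with
bilinear tensor product) whose unit object is simple. -/
class IsFusion : Prop extends IsFiniteSemisimple C where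
  simple_unit : Simple (𝟙_ C)

attribute [instance] IsFusion.simple_unit

section Trace
variable [IsFusion C]

/-- The identification of `End(1)` with `ℂ`. -/
def endScalar (e : 𝟙_ C ⟶ 𝟙_ C) : ℂ := (endomorphism_simple_eq_smul_id ℂ e).choose

/-- The trace `ev_{X*} ∘ (f ⊗ id) ∘ coev_X` of a morphism `f : X ⟶ X**`. -/
def categoricalTrace {X : C} (f : X ⟶ X✶✶) : ℂ :=
  endScalar (η_ X X✶ ≫ f ▷ X✶ ≫ ε_ X✶ X✶✶)

variable (j : PivotalStructure C)

/-- The pivotal trace of an endomorphism `g`, the trace of `j_X ∘ g`. -/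
def pivotalTrace {X : C} (g : X ⟶ X) : ℂ := categoricalTrace (g ≫ (j.iso X).hom)

/-- A pivotal structure is spherical if each object and its dual have the same pivotal dimension. -/
def IsSpherical : Prop :=
  ∀ X : C, categoricalTrace (j.iso X).hom = categoricalTrace (j.iso X✶).hom

/-- The global dimension: the sum over the (finitely many) isomorphism classes of simple objects `X`
of `ptr(id_X) ptr(id_{X*})`. -/
def globalDim : ℂ :=
  ∑ᶠ c : {c : Quotient (isIsomorphicSetoid C) // ∃ S : C, Simple S ∧ ⟦S⟧ = c},
    pivotalTrace j (𝟙 c.1.out) * pivotalTrace j (𝟙 c.1.out✶)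

/-- The ribbon structure `θ_V = u_V⁻¹ ∘ j_V` of the Drinfeld center, on underlying objects. -/
def twist (V : Center C) : End V.1 := (j.iso V.1).hom ≫ inv (drinfeld V)

universe v₃ u₃
variable {M : Type u₃} [Category.{v₃} M] [Abelian M] [Linear ℂ M] [MonoidalLeftAction C M]

/-- The `n`-th indicator `(dim C)⁻¹ ptr(θ_{K F} ^ n)` of an object `F` of the dual category, computed
with an adjoint `K` of `centralAction C M`. The pivotal trace in the Drinfeld center is the one of the
underlying endomorphism in `C`: the forgetful functor strictly preserves tensor products, duals,
evaluations, coevaluations and the pivotal structure. -/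
def indicator (K : ModuleEnd C M ⥤ Center C) (n : ℕ) (F : ModuleEnd C M) : ℂ :=
  (globalDim j)⁻¹ * pivotalTrace j (twist j (K.obj F) ^ n : End (K.obj F).1)

end Trace
end Linear

section Indecomposable
universe v₁ u₁ v₃ u₃
variable (C : Type u₁) [Category.{v₁} C] [MonoidalCategory C]
variable (M : Type u₃) [Category.{v₃} M] [Abelian M] [MonoidalLeftAction C M]
open MonoidalLeftAction

/-- The semisimple module category `M` is nonzero and is not a direct sum of two nonzero module
subcategories `P` and `Q`. -/
structure IsIndecomposable : Prop where
  nonzero : ∃ m : M, ¬ IsZero m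
  indecomposable (P Q : ObjectProperty M) [P.IsClosedUnderIsomorphisms]
    [Q.IsClosedUnderIsomorphisms]
    (hP : ∀ (X : C) (m : M), P m → P (X ⊙ₗ m)) (hQ : ∀ (X : C) (m : M), Q m → Q (X ⊙ₗ m))
    (hPQ : ∀ p q : M, P p → Q q → ∀ f : p ⟶ q, f = 0)
    (hQP : ∀ p q : M, P p → Q q → ∀ f : q ⟶ p, f = 0)
    (h : ∀ m : M, ∃ p q : M, P p ∧ Q q ∧ Nonempty (m ≅ p ⊞ q)) :
    (∀ p : M, P p → IsZero p) ∨ (∀ q : M, Q q → IsZero q)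

end Indecomposable

section PreservesPivotal
universe v₁ u₁ v₂ u₂
variable {C : Type u₁} [Category.{v₁} C] [MonoidalCategory C] [RigidCategory C]
variable {D : Type u₂} [Category.{v₂} D] [MonoidalCategory D] [RigidCategory D]
variable (Φ : C ⥤ D) [Φ.Monoidal]
open Functor.LaxMonoidal Functor.OplaxMonoidal

/-- The canonical morphism `Φ(X*) ⟶ Φ(X)*` of a monoidal functor, equal to
`(Φ(ev_X) ⊗ id) ∘ (id ⊗ coev_{Φ X})`; it is invertible. -/
def dualityTransform (X : C) : Φ.obj X✶ ⟶ (Φ.obj X)✶ :=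
  (ρ_ (Φ.obj X✶)).inv ≫ Φ.obj X✶ ◁ η_ (Φ.obj X) (Φ.obj X)✶ ≫ (α_ _ _ _).inv ≫
    (μ Φ X✶ X ≫ Φ.map (ε_ X X✶) ≫ η Φ) ▷ (Φ.obj X)✶ ≫ (λ_ (Φ.obj X)✶).hom

/-- `Φ` preserves the pivotal structures: `ξ_X ∘ Φ(j_X) = j_{Φ X}`, with `ξ_X = (χ_X*)⁻¹ ∘ χ_{X*}` the
canonical isomorphism `Φ(X**) ≅ Φ(X)**` and `χ` the duality transformation `Φ(X*) ≅ Φ(X)*`. -/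
def PreservesPivotal (jC : PivotalStructure C) (jD : PivotalStructure D) : Prop :=
  ∀ X : C, Φ.map (jC.iso X).hom ≫ dualityTransform Φ X✶ =
    (jD.iso (Φ.obj X)).hom ≫ rightAdjointMate (dualityTransform Φ X)

end PreservesPivotal
end DualFS

end

open DualFS

/-!
The action of `C` on `M` makes `V ↦ Nat (V ⊙ -, F)` a linear presheaf on `C` for each endofunctor
`F` of `M`. On a finite semisimple category such a presheaf is representable as soon as its values
are finite-dimensional (`exists_isCouniversal`), which holds because a natural transformation is
determined by its components at the finitely many simple objects (`finiteDimensional_natTrans`). Let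
`P` be the representing object. By duality `X ⊗ P` represents the transformations to `X ⊙ F -` and
`P ⊗ X` those to `F (X ⊙ -)` (`IsCouniversal.whiskerLeft`, `IsCouniversal.whiskerRight`). A module
structure on `F` identifies these two functors, hence gives a half-braiding `P ⊗ X ≅ X ⊗ P`, and `P`
with this half-braiding is the value at `F` of a right adjoint of the central action
(`centralAction_isLeftAdjoint`).

For the equality of indicators, a monoidal equivalence `Φ : C ⥤ D` induces an equivalence
`centerFunctor Φ` of the Drinfeld centers. The functor `Φ*` is fully faithful, and the central
action of `C` is the composite of `centerFunctor Φ`, the central action of `D` and `Φ*`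
(`centralActionIso`). By uniqueness of adjoints, any two right (or any two left) adjoints `K`, `K'`
of the central actions therefore satisfy `centerFunctor Φ (K (Φ* F)) ≅ K' F`
(`nonempty_iso_of_rightAdjoint`, `nonempty_iso_of_leftAdjoint`).

It remains to compare traces. The trace of a power of the twist depends only on the isomorphism
class in the center (`pivotalTrace_twist_pow_of_iso`). As `Φ` preserves the pivotal structures it
preserves pivotal traces (`pivotalTrace_map`) and the global dimension (`globalDim_eq`). It preserves
the Drinfeld morphism `V ⟶ V**` (`map_drinfeld`) because this morphism is characterized by its pairing
with `V*`, which is the evaluation of `V` composed with the half-braiding (`drinfeld_pairing`); so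
it preserves the twist (`map_twist`).
-/

noncomputable section
namespace DualFS

attribute [local instance] Abelian.hasFiniteBiproducts

local postfix:max "✶" => HasRightDual.rightDual

/-! ### Representable presheaves on a semisimple category -/

section Couniversal
universe v₁ u₁ v₂ u₂
variable {C : Type u₁} [Category.{v₁} C] {E : Type u₂} [Category.{v₂} E]

/-- The morphism `e : L P ⟶ Y` is universal among the morphisms from values of `L` to `Y`; that is,
`(P, e)` represents the presheaf `V ↦ Hom (L V, Y)`. -/
def IsCouniversal (L : C ⥤ E) {Y : E} {P : C} (e : L.obj P ⟶ Y) : Prop :=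
  ∀ V : C, Function.Bijective fun g : V ⟶ P => L.map g ≫ e

/-- Universality of `e` may be tested on one object of each isomorphism class. -/
theorem bijective_of_iso (L : C ⥤ E) {Y : E} {P : C} (e : L.obj P ⟶ Y) {V W : C} (i : V ≅ W)
    (h : Function.Bijective fun g : W ⟶ P => L.map g ≫ e) :
    Function.Bijective fun g : V ⟶ P => L.map g ≫ e := by
  constructor
  · intro g g' hg
    rw [← cancel_epi i.inv]
    refine h.1 ?_
    dsimp only at hg ⊢
    rw [L.map_comp, L.map_comp, Category.assoc, Category.assoc, hg]
  · intro φ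
    obtain ⟨g, hg⟩ := h.2 (L.map i.inv ≫ φ)
    refine ⟨i.hom ≫ g, ?_⟩
    dsimp only at hg ⊢
    rw [L.map_comp, Category.assoc, hg, ← L.map_comp_assoc, i.hom_inv_id, L.map_id,
      Category.id_comp]

end Couniversal

section Semisimple
universe v₁ u₁ v₂ u₂
variable {C : Type u₁} [Category.{v₁} C] [Abelian C]
variable {E : Type u₂} [Category.{v₂} E] [Preadditive E]

/-- An additive functor maps the projections and injections of a biproduct to a decomposition of the
identity. No biproducts are needed in the target. -/
theorem sum_map_π_comp_ι (L : C ⥤ E) [L.Additive] {n : ℕ} (S : Fin n → C) :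
    ∑ a, L.map (biproduct.π S a) ≫ L.map (biproduct.ι S a) = 𝟙 (L.obj (⨁ S)) := by
  simp only [← L.map_comp]
  rw [← L.map_sum, biproduct.total, L.map_id]

theorem natTrans_ext_of_simple [Linear ℂ C] [IsFiniteSemisimple C] {G H : C ⥤ E} [G.Additive]
    (α β : G ⟶ H)
    (h : ∀ S : C, Simple S → α.app S = β.app S) : α = β := by
  ext X
  obtain ⟨n, S, hS, ⟨i⟩⟩ := IsFiniteSemisimple.semisimple X
  have key : α.app (⨁ S) = β.app (⨁ S) := by
    rw [← Category.id_comp (α.app _), ← Category.id_comp (β.app _), ← sum_map_π_comp_ι G S,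
      Preadditive.sum_comp, Preadditive.sum_comp]
    refine Finset.sum_congr rfl fun a _ => ?_
    rw [Category.assoc, Category.assoc, α.naturality, β.naturality, h _ (hS a)]
  rw [← cancel_epi (G.map i.inv), α.naturality, β.naturality, key]

variable (C) in
/-- The index set of the isomorphism classes of simple objects. -/
abbrev SimpleClass : Type u₁ :=
  {c : Quotient (isIsomorphicSetoid C) // ∃ S : C, Simple S ∧ ⟦S⟧ = c}

namespace SimpleClass

instance [Linear ℂ C] [IsFiniteSemisimple C] : Finite (SimpleClass C) := IsFiniteSemisimple.finite

/-- The chosen representative of an isomorphism class of simple objects. -/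
abbrev rep (c : SimpleClass C) : C := c.1.out

instance (c : SimpleClass C) : Simple c.rep := by
  obtain ⟨S, hS, h⟩ := c.2
  have : IsIsomorphic S c.rep := Quotient.exact (h.trans (Quotient.out_eq c.1).symm)
  exact Simple.of_iso this.some.symm

/-- The isomorphism class of a simple object. -/
def mk (S : C) (hS : Simple S) : SimpleClass C := ⟨⟦S⟧, S, hS, rfl⟩

theorem nonempty_iso_rep_mk (S : C) (hS : Simple S) : Nonempty (S ≅ (mk S hS).rep) :=
  Quotient.exact (Quotient.out_eq (s := isIsomorphicSetoid C) ⟦S⟧).symm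

theorem eq_of_iso {c d : SimpleClass C} (i : c.rep ≅ d.rep) : c = d :=
  Subtype.ext (by
    rw [← Quotient.out_eq c.1, ← Quotient.out_eq d.1]
    exact Quotient.sound ⟨i⟩)

theorem hom_eq_zero {c d : SimpleClass C} (h : c ≠ d) (f : c.rep ⟶ d.rep) : f = 0 := by
  by_contra hf
  have := isIso_of_hom_simple hf
  exact h (eq_of_iso (asIso f))

end SimpleClass

/-- Natural transformations out of an additive functor on a finite semisimple category are
determined by their finitely many components at simple objects, so they form a finite-dimensional
space if the hom spaces of the target are finite-dimensional. -/
theorem finiteDimensional_natTrans [Linear ℂ C] [IsFiniteSemisimple C] [Linear ℂ E] (G H : C ⥤ E)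
    [G.Additive] [∀ X Y : E, FiniteDimensional ℂ (X ⟶ Y)] : FiniteDimensional ℂ (G ⟶ H) := by
  let f : (G ⟶ H) →ₗ[ℂ] ((c : SimpleClass C) → (G.obj c.rep ⟶ H.obj c.rep)) :=
    LinearMap.pi fun c => NatTrans.appLinearMap c.rep
  have := Fintype.ofFinite (SimpleClass C)
  refine FiniteDimensional.of_injective f fun α β h => natTrans_ext_of_simple α β fun S hS => ?_
  obtain ⟨i⟩ := SimpleClass.nonempty_iso_rep_mk S hS
  have h' : α.app (SimpleClass.mk S hS).rep = β.app _ := congrFun h (SimpleClass.mk S hS)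
  rw [← cancel_epi (G.map i.inv), α.naturality, β.naturality, h']

variable (L : C ⥤ E)

/-- Let `d c` be the dimension of `Hom (L S, Y)` for a simple object `S` of class `c`. By Schur's
lemma, a morphism from `S` to the sum of `d c` copies of the simple object of each class `c` amounts
to a coordinate vector of length `d c`, hence to an element of `Hom (L S, Y)`. -/
theorem bijective_of_simple [L.Additive] [Linear ℂ C] [Linear ℂ E] [L.Linear ℂ]
    [∀ X Y : C, FiniteDimensional ℂ (X ⟶ Y)] {Y : E} {d : SimpleClass C → ℕ}
    [Fintype (SimpleClass C)]
    (b : ∀ c : SimpleClass C, Module.Basis (Fin (d c)) ℂ (L.obj c.rep ⟶ Y)) (c : SimpleClass C) :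
    Function.Bijective fun g : c.rep ⟶ ⨁ fun p : Σ c : SimpleClass C, Fin (d c) => p.1.rep =>
      L.map g ≫ ∑ p, L.map (biproduct.π _ p) ≫ b p.1 p.2 := by
  classical
  set S : (Σ c : SimpleClass C, Fin (d c)) → C := fun p => p.1.rep
  -- If `g` has coordinates `x k` in the copies of `c.rep`, its image has coordinates `x` in `b c`.
  have key : ∀ g : c.rep ⟶ ⨁ S, ∀ x : Fin (d c) → ℂ,
      (∀ k, g ≫ biproduct.π S ⟨c, k⟩ = x k • 𝟙 _) →
      L.map g ≫ ∑ p, L.map (biproduct.π _ p) ≫ b p.1 p.2 = ∑ k, x k • b c k := by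
    intro g x hx
    rw [Preadditive.comp_sum, Fintype.sum_sigma, Finset.sum_eq_single c]
    · refine Finset.sum_congr rfl fun k _ => ?_
      rw [← Category.assoc, ← L.map_comp, hx k, L.map_smul, L.map_id, Linear.smul_comp,
        Category.id_comp]
    · intro c' _ h
      refine Finset.sum_eq_zero fun k _ => ?_
      rw [← Category.assoc, ← L.map_comp,
        SimpleClass.hom_eq_zero h.symm (g ≫ biproduct.π S ⟨c', k⟩), L.map_zero, zero_comp]
    · simp
  have coord : ∀ g : c.rep ⟶ ⨁ S, ∃ x : Fin (d c) → ℂ,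
      ∀ k, g ≫ biproduct.π S ⟨c, k⟩ = x k • 𝟙 _ := fun g => by
    choose x hx using fun k => endomorphism_simple_eq_smul_id ℂ (g ≫ biproduct.π S ⟨c, k⟩)
    exact ⟨x, fun k => (hx k).symm⟩
  constructor
  · intro g g' h
    obtain ⟨x, hx⟩ := coord g
    obtain ⟨x', hx'⟩ := coord g'
    dsimp only at h
    rw [key g x hx, key g' x' hx'] at h
    have hxx : x = x' := (b c).equivFun.symm.injective (by
      rw [(b c).equivFun_symm_apply, (b c).equivFun_symm_apply, h])
    refine biproduct.hom_ext _ _ fun p => ?_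
    obtain ⟨c', k⟩ := p
    by_cases hc : c = c'
    · subst hc
      rw [hx, hx', hxx]
    · rw [SimpleClass.hom_eq_zero hc (g ≫ biproduct.π S ⟨c', k⟩),
        SimpleClass.hom_eq_zero hc (g' ≫ biproduct.π S ⟨c', k⟩)]
  · intro φ
    refine ⟨∑ k, (b c).repr φ k • biproduct.ι S ⟨c, k⟩, ?_⟩
    refine (key _ ((b c).repr φ) fun k => ?_).trans ((b c).sum_repr φ)
    rw [Preadditive.sum_comp, Finset.sum_eq_single k]
    · simp [S]
    · intro k' _ h
      have : (⟨c, k'⟩ : Σ c : SimpleClass C, Fin (d c)) ≠ ⟨c, k⟩ := by simpa using h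
      rw [Linear.smul_comp, biproduct.ι_π_ne _ this, smul_zero]
    · simp

/-- Both sides of the representability condition turn finite biproducts in `V` into products. -/
theorem bijective_of_biproduct [L.Additive] {Y : E} {P : C} (e : L.obj P ⟶ Y) {n : ℕ}
    (S : Fin n → C) (h : ∀ a, Function.Bijective fun g : S a ⟶ P => L.map g ≫ e) :
    Function.Bijective fun g : ⨁ S ⟶ P => L.map g ≫ e := by
  classical
  constructor
  · intro g g' hg
    refine biproduct.hom_ext' _ _ fun a => (h a).1 ?_
    dsimp only at hg ⊢
    rw [L.map_comp, L.map_comp, Category.assoc, Category.assoc, hg]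
  · intro φ
    choose g hg using fun a => (h a).2 (L.map (biproduct.ι S a) ≫ φ)
    refine ⟨biproduct.desc g, ?_⟩
    dsimp only at hg ⊢
    rw [← Category.id_comp φ, ← sum_map_π_comp_ι L S, Preadditive.sum_comp,
      biproduct.desc_eq, L.map_sum, Preadditive.sum_comp]
    refine Finset.sum_congr rfl fun a _ => ?_
    rw [L.map_comp, Category.assoc, Category.assoc, hg]

/-- A `ℂ`-linear presheaf `V ↦ Hom (L V, Y)` on a finite semisimple category is representable if its
values are finite-dimensional: it is represented by the sum, over the simple objects `S`, of
`dim Hom (L S, Y)` copies of `S`. -/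
theorem exists_isCouniversal [L.Additive] [Linear ℂ C] [Linear ℂ E] [L.Linear ℂ]
    [IsFiniteSemisimple C] (Y : E)
    (hY : ∀ X : C, FiniteDimensional ℂ (L.obj X ⟶ Y)) :
    ∃ (P : C) (e : L.obj P ⟶ Y), IsCouniversal L e := by
  have := Fintype.ofFinite (SimpleClass C)
  let b := fun c : SimpleClass C => Module.finBasis ℂ (L.obj c.rep ⟶ Y)
  refine ⟨_, ∑ p, L.map (biproduct.π (fun p : Σ c : SimpleClass C,
    Fin (Module.finrank ℂ (L.obj c.rep ⟶ Y)) => p.1.rep) p) ≫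
    b p.1 p.2, fun V => ?_⟩
  obtain ⟨n, S, hS, ⟨i⟩⟩ := IsFiniteSemisimple.semisimple V
  refine bijective_of_iso L _ i (bijective_of_biproduct L _ S fun a => ?_)
  exact bijective_of_iso L _ (SimpleClass.nonempty_iso_rep_mk (S a) (hS a)).some
    (bijective_of_simple L b _)

end Semisimple

/-! ### Tensoring a representing object on either side -/

section ActionUniversal
open MonoidalLeftAction
universe v₁ u₁ v₃ u₃
variable {C : Type u₁} [Category.{v₁} C] [MonoidalCategory C]
variable {M : Type u₃} [Category.{v₃} M] [MonoidalLeftAction C M]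

variable (C M) in
/-- The action as a functor from `C` to the endofunctors of `M`, `V ↦ V ⊙ -`. -/
abbrev actionFunctor : C ⥤ M ⥤ M where
  obj V := { obj := fun m => V ⊙ₗ m, map := fun f => V ⊴ₗ f }
  map f := { app := fun m => f ⊵ₗ m, naturality := fun _ _ g => action_exchange f g }
  map_id V := NatTrans.ext (funext fun m => id_actionHomLeft V m)
  map_comp f g := NatTrans.ext (funext fun m => comp_actionHomLeft f g m)

/-- The functor `X ⊙ T -`. -/
abbrev actAfter (X : C) (T : M ⥤ M) : M ⥤ M where
  obj m := X ⊙ₗ T.obj m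
  map f := X ⊴ₗ T.map f

/-- The functor `T (X ⊙ -)`. -/
abbrev actBefore (T : M ⥤ M) (X : C) : M ⥤ M where
  obj m := T.obj (X ⊙ₗ m)
  map f := T.map (X ⊴ₗ f)

section Naturality
variable {T : M ⥤ M} {P : C} (e : (actionFunctor C M).obj P ⟶ T)

theorem act_app_nat {m m' : M} (f : m ⟶ m') : P ⊴ₗ f ≫ e.app m' = e.app m ≫ T.map f :=
  e.naturality f

theorem act_tensor_nat {X Y : C} {m m' : M} (f : m ⟶ m') :
    X ⊴ₗ Y ⊴ₗ f ≫ (αₗ X Y m').inv = (αₗ X Y m).inv ≫ (X ⊗ Y) ⊴ₗ f := by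
  rw [tensor_actionHomRight, Iso.inv_hom_id_assoc]

/-- The transformation `(X ⊗ P) ⊙ - ⟶ X ⊙ T -` obtained from `e : P ⊙ - ⟶ T`. -/
abbrev leftWhiskerAct (X : C) : (actionFunctor C M).obj (X ⊗ P) ⟶ actAfter X T where
  app m := (αₗ X P m).hom ≫ X ⊴ₗ e.app m
  naturality m m' f := by
    dsimp only
    rw [tensor_actionHomRight, Category.assoc, Category.assoc, Category.assoc,
      Iso.inv_hom_id_assoc, ← actionHomRight_comp, ← actionHomRight_comp, act_app_nat]

/-- The transformation `(P ⊗ X) ⊙ - ⟶ T (X ⊙ -)` obtained from `e : P ⊙ - ⟶ T`. -/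
abbrev rightWhiskerAct (X : C) : (actionFunctor C M).obj (P ⊗ X) ⟶ actBefore T X where
  app m := (αₗ P X m).hom ≫ e.app (X ⊙ₗ m)
  naturality m m' f := by
    dsimp only
    rw [tensor_actionHomRight, Category.assoc, Category.assoc, Category.assoc,
      Iso.inv_hom_id_assoc, act_app_nat]

end Naturality

section Transpose
variable (X Y : C) [ExactPairing X Y]

/-- The unit of the adjunction of `Y ⊙ -` and `X ⊙ -`. -/
def actCoev (m : M) : m ⟶ X ⊙ₗ Y ⊙ₗ m := (λₗ[C] m).inv ≫ η_ X Y ⊵ₗ m ≫ (αₗ X Y m).hom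

/-- The counit of the adjunction of `Y ⊙ -` and `X ⊙ -`. -/
def actEv (m : M) : Y ⊙ₗ X ⊙ₗ m ⟶ m := (αₗ Y X m).inv ≫ ε_ X Y ⊵ₗ m ≫ (λₗ[C] m).hom

theorem actCoev_nat {m m' : M} (f : m ⟶ m') :
    f ≫ actCoev X Y m' = actCoev X Y m ≫ X ⊴ₗ Y ⊴ₗ f := act_unit_nat X Y f

theorem actEv_nat {m m' : M} (f : m ⟶ m') :
    Y ⊴ₗ X ⊴ₗ f ≫ actEv X Y m' = actEv X Y m ≫ f := by
  have h := act_counit_nat X Y f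
  simpa only [actEv, Category.assoc] using h

theorem actCoev_actEv_left (m : M) : Y ⊴ₗ actCoev X Y m ≫ actEv X Y (Y ⊙ₗ m) = 𝟙 _ :=
  act_left_triangle X Y m

theorem actCoev_actEv_right (m : M) : actCoev X Y (X ⊙ₗ m) ≫ X ⊴ₗ actEv X Y m = 𝟙 _ :=
  act_right_triangle X Y m

/-- The adjunction of `Y ⊙ -` and `X ⊙ -`, applied after a functor: transformations from
`(Y ⊗ V) ⊙ - ≅ Y ⊙ (V ⊙ -)` to `T` are the same as transformations from `V ⊙ -` to `X ⊙ T -`. -/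
def leftTranspose (V : C) (T : M ⥤ M) :
    ((actionFunctor C M).obj (Y ⊗ V) ⟶ T) ≃ ((actionFunctor C M).obj V ⟶ actAfter X T) where
  toFun ψ :=
    { app := fun m => actCoev X Y (V ⊙ₗ m) ≫ X ⊴ₗ ((αₗ Y V m).inv ≫ ψ.app m)
      naturality := fun m m' f => by
        dsimp only
        rw [← Category.assoc, actCoev_nat, Category.assoc, Category.assoc, ← actionHomRight_comp,
          ← actionHomRight_comp, ← Category.assoc (Y ⊴ₗ V ⊴ₗ f), act_tensor_nat, Category.assoc,
          Category.assoc, act_app_nat] }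
  invFun φ :=
    { app := fun m => (αₗ Y V m).hom ≫ Y ⊴ₗ φ.app m ≫ actEv X Y (T.obj m)
      naturality := fun m m' f => by
        dsimp only
        have h : V ⊴ₗ f ≫ φ.app m' = φ.app m ≫ X ⊴ₗ T.map f := act_app_nat φ f
        rw [tensor_actionHomRight, Category.assoc, Category.assoc, Category.assoc, Category.assoc,
          Iso.inv_hom_id_assoc, ← actionHomRight_comp_assoc, h, actionHomRight_comp_assoc,
          actEv_nat] }
  left_inv ψ := by
    ext m
    dsimp only
    rw [actionHomRight_comp, Category.assoc, actEv_nat, ← Category.assoc (Y ⊴ₗ actCoev X Y _),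
      actCoev_actEv_left, Category.id_comp, Iso.hom_inv_id_assoc]
  right_inv φ := by
    ext m
    dsimp only
    rw [Iso.inv_hom_id_assoc, actionHomRight_comp, ← Category.assoc, ← actCoev_nat, Category.assoc,
      actCoev_actEv_right, Category.comp_id]

/-- The adjunction of `Y ⊙ -` and `X ⊙ -`, applied before a functor: transformations from
`(V ⊗ X) ⊙ - ≅ V ⊙ (X ⊙ -)` to `T` are the same as transformations from `V ⊙ -` to `T (Y ⊙ -)`. -/
def rightTranspose (V : C) (T : M ⥤ M) :
    ((actionFunctor C M).obj (V ⊗ X) ⟶ T) ≃ ((actionFunctor C M).obj V ⟶ actBefore T Y) where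
  toFun ψ :=
    { app := fun m => V ⊴ₗ actCoev X Y m ≫ (αₗ V X (Y ⊙ₗ m)).inv ≫ ψ.app (Y ⊙ₗ m)
      naturality := fun m m' f => by
        dsimp only
        rw [← actionHomRight_comp_assoc, actCoev_nat, actionHomRight_comp_assoc, Category.assoc,
          Category.assoc, ← act_app_nat, ← Category.assoc (V ⊴ₗ X ⊴ₗ Y ⊴ₗ f), act_tensor_nat,
          Category.assoc] }
  invFun φ :=
    { app := fun m => (αₗ V X m).hom ≫ φ.app (X ⊙ₗ m) ≫ T.map (actEv X Y m)
      naturality := fun m m' f => by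
        dsimp only
        have h : V ⊴ₗ X ⊴ₗ f ≫ φ.app (X ⊙ₗ m') = φ.app (X ⊙ₗ m) ≫ T.map (Y ⊴ₗ X ⊴ₗ f) :=
          act_app_nat φ (X ⊴ₗ f)
        rw [tensor_actionHomRight, Category.assoc, Category.assoc, Category.assoc, Category.assoc,
          Iso.inv_hom_id_assoc, ← Category.assoc (V ⊴ₗ X ⊴ₗ f), h, Category.assoc, ← T.map_comp,
          ← T.map_comp, actEv_nat] }
  left_inv ψ := by
    ext m
    dsimp only
    rw [Category.assoc, Category.assoc, ← act_app_nat, ← Category.assoc (αₗ V X _).inv,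
      ← act_tensor_nat, Category.assoc, ← actionHomRight_comp_assoc, actCoev_actEv_right,
      actionHomRight_id, Category.id_comp, Iso.hom_inv_id_assoc]
  right_inv φ := by
    ext m
    have h : V ⊴ₗ actCoev X Y m ≫ φ.app (X ⊙ₗ Y ⊙ₗ m) =
        φ.app m ≫ T.map (Y ⊴ₗ actCoev X Y m) := act_app_nat φ (actCoev X Y m)
    dsimp only
    rw [Iso.inv_hom_id_assoc, ← Category.assoc, h, Category.assoc, ← T.map_comp,
      actCoev_actEv_left, T.map_id, Category.comp_id]

variable {T : M ⥤ M} {P : C} (e : (actionFunctor C M).obj P ⟶ T)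

/-- The action turns transposition in `C` (from `Y ⊗ V ⟶ P` to `V ⟶ X ⊗ P`) into transposition of
transformations. -/
theorem map_tensorLeftHomEquiv_comp (V : C) (g : Y ⊗ V ⟶ P) :
    (actionFunctor C M).map (tensorLeftHomEquiv V X Y P g) ≫ leftWhiskerAct e X =
      leftTranspose X Y V T ((actionFunctor C M).map g ≫ e) := by
  ext m
  change ((λ_ V).inv ≫ η_ X Y ▷ V ≫ (α_ X Y V).hom ≫ X ◁ g) ⊵ₗ m ≫ (αₗ X P m).hom ≫
    X ⊴ₗ e.app m = ((λₗ[C] (V ⊙ₗ m)).inv ≫ η_ X Y ⊵ₗ (V ⊙ₗ m) ≫ (αₗ X Y (V ⊙ₗ m)).hom) ≫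
    X ⊴ₗ ((αₗ Y V m).inv ≫ g ⊵ₗ m ≫ e.app m)
  simp only [comp_actionHomLeft, leftUnitor_inv_act, whiskerRight_actionHomLeft, associator_act,
    whiskerLeft_actionHomLeft, Category.assoc, actionHomRight_comp, Iso.inv_hom_id_assoc]

/-- The action turns transposition in `C` (from `V ⊗ X ⟶ P` to `V ⟶ P ⊗ Y`) into transposition of
transformations. -/
theorem map_tensorRightHomEquiv_comp (V : C) (g : V ⊗ X ⟶ P) :
    (actionFunctor C M).map (tensorRightHomEquiv V X Y P g) ≫ rightWhiskerAct e Y =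
      rightTranspose X Y V T ((actionFunctor C M).map g ≫ e) := by
  ext m
  change ((ρ_ V).inv ≫ V ◁ η_ X Y ≫ (α_ V X Y).inv ≫ g ▷ Y) ⊵ₗ m ≫ (αₗ P Y m).hom ≫
    e.app (Y ⊙ₗ m) = V ⊴ₗ ((λₗ[C] m).inv ≫ η_ X Y ⊵ₗ m ≫ (αₗ X Y m).hom) ≫
      (αₗ V X (Y ⊙ₗ m)).inv ≫ g ⊵ₗ (Y ⊙ₗ m) ≫ e.app (Y ⊙ₗ m)
  simp only [comp_actionHomLeft, rightUnitor_inv_act, whiskerRight_actionHomLeft,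
    associator_inv_act, whiskerLeft_actionHomLeft, Category.assoc, actionHomRight_comp,
    Iso.inv_hom_id_assoc]

end Transpose

variable {T : M ⥤ M} {P : C} {e : (actionFunctor C M).obj P ⟶ T}

/-- If `P` represents the transformations to `T`, then `X ⊗ P` represents those to `X ⊙ T -`. -/
theorem IsCouniversal.whiskerLeft
    (h : IsCouniversal (actionFunctor C M) e) (X : C) [HasRightDual X] :
    IsCouniversal (actionFunctor C M) (leftWhiskerAct e X) := fun V => by
  have := ((leftTranspose X Xᘁ V T).bijective.comp (h (Xᘁ ⊗ V))).comp
    (tensorLeftHomEquiv V X Xᘁ P).symm.bijective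
  convert this using 1
  ext1 g
  dsimp only [Function.comp_apply]
  rw [← map_tensorLeftHomEquiv_comp, Equiv.apply_symm_apply]

/-- If `P` represents the transformations to `T`, then `P ⊗ X` represents those to `T (X ⊙ -)`. -/
theorem IsCouniversal.whiskerRight
    (h : IsCouniversal (actionFunctor C M) e) (X : C) [HasLeftDual X] :
    IsCouniversal (actionFunctor C M) (rightWhiskerAct e X) := fun V => by
  have := ((rightTranspose (ᘁX) X V T).bijective.comp (h (V ⊗ ᘁX))).comp
    (tensorRightHomEquiv V (ᘁX) X P).symm.bijective
  convert this using 1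
  ext1 g
  dsimp only [Function.comp_apply]
  rw [← map_tensorRightHomEquiv_comp, Equiv.apply_symm_apply]

end ActionUniversal

/-! ### The half-braiding of a representing object and the right adjoint -/

section CouniversalBraiding
open MonoidalLeftAction Functor.LaxLeftLinear Functor.OplaxLeftLinear
universe v₁ u₁ v₃ u₃
variable {C : Type u₁} [Category.{v₁} C] [MonoidalCategory C]
variable {M : Type u₃} [Category.{v₃} M] [MonoidalLeftAction C M]
variable {F : M ⥤ M} {P : C} {e : (actionFunctor C M).obj P ⟶ F}

theorem IsCouniversal.hom_ext (h : IsCouniversal (actionFunctor C M) e) {V : C} {g g' : V ⟶ P}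
    (hg : ∀ m : M, g ⊵ₗ m ≫ e.app m = g' ⊵ₗ m ≫ e.app m) : g = g' :=
  (h V).1 (NatTrans.ext (funext hg))

theorem IsCouniversal.hom_ext_left (h : IsCouniversal (actionFunctor C M) e) {X V : C}
    [HasRightDual X] {g g' : V ⟶ X ⊗ P}
    (hg : ∀ m : M, g ⊵ₗ m ≫ (αₗ X P m).hom ≫ X ⊴ₗ e.app m =
      g' ⊵ₗ m ≫ (αₗ X P m).hom ≫ X ⊴ₗ e.app m) : g = g' :=
  (h.whiskerLeft X).hom_ext hg

theorem IsCouniversal.hom_ext_right (h : IsCouniversal (actionFunctor C M) e) {X V : C}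
    [HasLeftDual X] {g g' : V ⟶ P ⊗ X}
    (hg : ∀ m : M, g ⊵ₗ m ≫ (αₗ P X m).hom ≫ e.app (X ⊙ₗ m) =
      g' ⊵ₗ m ≫ (αₗ P X m).hom ≫ e.app (X ⊙ₗ m)) : g = g' :=
  (h.whiskerRight X).hom_ext hg

variable [F.LeftLinear C]

/-- The transformation `(P ⊗ X) ⊙ - ⟶ F (X ⊙ -) ≅ X ⊙ F -` factors through `X ⊗ P`. -/
theorem IsCouniversal.exists_braidHom (h : IsCouniversal (actionFunctor C M) e) (X : C)
    [HasRightDual X] : ∃ g : P ⊗ X ⟶ X ⊗ P, ∀ m : M,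
      g ⊵ₗ m ≫ (αₗ X P m).hom ≫ X ⊴ₗ e.app m =
        (αₗ P X m).hom ≫ e.app (X ⊙ₗ m) ≫ δₗ F X m := by
  let φ : (actionFunctor C M).obj (P ⊗ X) ⟶ actAfter X F :=
    rightWhiskerAct e X ≫ { app := fun m => δₗ F X m
                            naturality := fun m m' f => δₗ_naturality_right F X f }
  obtain ⟨g, hg⟩ := (h.whiskerLeft X (P ⊗ X)).2 φ
  exact ⟨g, fun m => (congrArg (fun ψ => ψ.app m) hg).trans (Category.assoc _ _ _)⟩

/-- The transformation `(X ⊗ P) ⊙ - ⟶ X ⊙ F - ≅ F (X ⊙ -)` factors through `P ⊗ X`. -/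
theorem IsCouniversal.exists_braidInv (h : IsCouniversal (actionFunctor C M) e) (X : C)
    [HasLeftDual X] : ∃ g : X ⊗ P ⟶ P ⊗ X, ∀ m : M,
      g ⊵ₗ m ≫ (αₗ P X m).hom ≫ e.app (X ⊙ₗ m) =
        (αₗ X P m).hom ≫ X ⊴ₗ e.app m ≫ μₗ F X m := by
  let φ : (actionFunctor C M).obj (X ⊗ P) ⟶ actBefore F X :=
    leftWhiskerAct e X ≫ { app := fun m => μₗ F X m
                           naturality := fun m m' f => μₗ_naturality_right F X f }
  obtain ⟨g, hg⟩ := (h.whiskerRight X (X ⊗ P)).2 φ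
  exact ⟨g, fun m => (congrArg (fun ψ => ψ.app m) hg).trans (Category.assoc _ _ _)⟩

variable [RigidCategory C] (h : IsCouniversal (actionFunctor C M) e)

/-- Both `P ⊗ X` and `X ⊗ P` represent the transformations to `F (X ⊙ -) ≅ X ⊙ F -`; this is the
resulting isomorphism between them. -/
def couniversalBraid (X : C) : P ⊗ X ≅ X ⊗ P where
  hom := (h.exists_braidHom X).choose
  inv := (h.exists_braidInv X).choose
  hom_inv_id := h.hom_ext_right fun m => by
    rw [comp_actionHomLeft, Category.assoc, (h.exists_braidInv X).choose_spec,
      reassoc_of% (h.exists_braidHom X).choose_spec]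
    simp
  inv_hom_id := h.hom_ext_left fun m => by
    rw [comp_actionHomLeft, Category.assoc, (h.exists_braidHom X).choose_spec,
      reassoc_of% (h.exists_braidInv X).choose_spec]
    simp

/-- The braiding corresponds to the module structure `F (X ⊙ -) ≅ X ⊙ F -`. -/
theorem couniversalBraid_hom (X : C) (m : M) :
    (couniversalBraid h X).hom ⊵ₗ m ≫ (αₗ X P m).hom ≫ X ⊴ₗ e.app m =
      (αₗ P X m).hom ≫ e.app (X ⊙ₗ m) ≫ δₗ F X m := (h.exists_braidHom X).choose_spec m

theorem couniversalBraid_naturality {X Y : C} (f : X ⟶ Y) :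
    P ◁ f ≫ (couniversalBraid h Y).hom = (couniversalBraid h X).hom ≫ f ▷ P :=
  h.hom_ext_left fun m => by
    have e1 := act_app_nat e (f ⊵ₗ m)
    simp only [comp_actionHomLeft, Category.assoc, couniversalBraid_hom,
      whiskerLeft_actionHomLeft, whiskerRight_actionHomLeft, Iso.inv_hom_id_assoc,
      ← action_exchange, reassoc_of% (couniversalBraid_hom h X m), reassoc_of% e1,
      δₗ_naturality_left]

theorem couniversalBraid_tensor (X Y : C) :
    (couniversalBraid h (X ⊗ Y)).hom = (α_ _ _ _).inv ≫ ((couniversalBraid h X).hom ▷ Y) ≫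
      (α_ _ _ _).hom ≫ (X ◁ (couniversalBraid h Y).hom) ≫ (α_ _ _ _).inv :=
  h.hom_ext_left fun m => by
    have e1 := act_app_nat e (αₗ X Y m).hom
    have e2 : (αₗ X Y (P ⊙ₗ m)).inv ≫ (X ⊗ Y) ⊴ₗ e.app m ≫ (αₗ X Y (F.obj m)).hom =
        X ⊴ₗ Y ⊴ₗ e.app m := by
      rw [tensor_actionHomRight]; simp
    have e3 : X ⊴ₗ (couniversalBraid h Y).hom ⊵ₗ m ≫ X ⊴ₗ (αₗ Y P m).hom ≫ X ⊴ₗ Y ⊴ₗ e.app m =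
        X ⊴ₗ (αₗ P Y m).hom ≫ X ⊴ₗ e.app (Y ⊙ₗ m) ≫ X ⊴ₗ δₗ F Y m := by
      simp only [← actionHomRight_comp, couniversalBraid_hom]
    have e4 : X ⊴ₗ (αₗ P Y m).inv ≫ X ⊴ₗ (αₗ P Y m).hom = 𝟙 _ := by simp
    rw [← cancel_mono (αₗ X Y (F.obj m)).hom, Category.assoc, Category.assoc,
      reassoc_of% (couniversalBraid_hom h (X ⊗ Y) m), δₗ_associativity]
    simp only [comp_actionHomLeft, Category.assoc, e2, e3, whiskerLeft_actionHomLeft,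
      whiskerRight_actionHomLeft, associator_act, associator_inv_act, Iso.inv_hom_id_assoc,
      reassoc_of% e4, reassoc_of% (couniversalBraid_hom h X (Y ⊙ₗ m)), reassoc_of% e1]

/-- The object of the Drinfeld center whose underlying object `P` represents the transformations
`V ⊙ - ⟶ F` to a module functor `F`. -/
def couniversalCenter : Center C :=
  ⟨P, { β := couniversalBraid h
        monoidal := couniversalBraid_tensor h
        naturality := couniversalBraid_naturality h }⟩

/-- The universal transformation respects the module structures. -/
theorem actMu_couniversalCenter (X : C) (m : M) :
    actMu (couniversalCenter h).2 X m ≫ e.app (X ⊙ₗ m) = X ⊴ₗ e.app m ≫ μₗ F X m := by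
  have e1 : (couniversalBraid h X).inv ⊵ₗ m ≫ (couniversalBraid h X).hom ⊵ₗ m = 𝟙 _ := by
    rw [← comp_actionHomLeft]; simp
  have e2 := couniversalBraid_hom h X m =≫ μₗ F X m
  simp only [Category.assoc, Functor.LeftLinear.δₗ_comp_μₗ, Category.comp_id] at e2
  change ((αₗ X P m).inv ≫ (couniversalBraid h X).inv ⊵ₗ m ≫ (αₗ P X m).hom) ≫ _ = _
  rw [Category.assoc, Category.assoc, ← e2, reassoc_of% e1, Iso.inv_hom_id_assoc]

/-- A morphism to `P` is central if the transformation it induces respects the module structures. -/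
theorem couniversalCenter_comm {V : Center C} (g : V.1 ⟶ P)
    (hg : ∀ (X : C) (m : M), X ⊴ₗ (g ⊵ₗ m ≫ e.app m) ≫ μₗ F X m =
      actMu V.2 X m ≫ g ⊵ₗ (X ⊙ₗ m) ≫ e.app (X ⊙ₗ m)) (X : C) :
    g ▷ X ≫ (couniversalBraid h X).hom = (V.2.β X).hom ≫ X ◁ g :=
  h.hom_ext_left fun m => by
    have e1 := congrArg (fun k => actDelta V.2 X m ≫ k ≫ δₗ F X m) (hg X m)
    simp only [Category.assoc, Functor.LeftLinear.μₗ_comp_δₗ, Category.comp_id] at e1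
    rw [← Category.assoc (actDelta V.2 X m) (actMu V.2 X m), actDelta_actMu, Category.id_comp,
      actDelta, Category.assoc, Category.assoc] at e1
    simp only [comp_actionHomLeft, Category.assoc, couniversalBraid_hom,
      whiskerLeft_actionHomLeft, whiskerRight_actionHomLeft, Iso.inv_hom_id_assoc,
      ← actionHomRight_comp, ← e1, Iso.hom_inv_id_assoc]

end CouniversalBraiding

section RightAdjoint
open MonoidalLeftAction
universe v₁ u₁ v₃ u₃
variable {C : Type u₁} [Category.{v₁} C] [MonoidalCategory C]
variable {M : Type u₃} [Category.{v₃} M] [Abelian M] [Linear ℂ M] [MonoidalLeftAction C M]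

variable [Preadditive C] [Linear ℂ C] [BilinearAction C M] [RigidCategory C]

/-- The universal transformation to `F`, with `P` regarded as an object of the Drinfeld center, is
terminal among the morphisms to `F` from values of the central action. -/
theorem hasTerminal_costructuredArrow (F : ModuleEnd C M) {P : C}
    {e : (actionFunctor C M).obj P ⟶ F.functor} (h : IsCouniversal (actionFunctor C M) e) :
    HasTerminal (CostructuredArrow (centralAction C M) F) := by
  let c : (centralAction C M).obj (couniversalCenter h) ⟶ F :=
    { nat := { app := e.app, naturality := fun m m' f => e.naturality f }
      comm := fun X m => (actMu_couniversalCenter h X m).symm }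
  have key : ∀ A : CostructuredArrow (centralAction C M) F,
      ∃ g : A.left ⟶ couniversalCenter h, (centralAction C M).map g ≫ c = A.hom := fun A => by
    obtain ⟨g, hg⟩ := (h A.left.1).2 { app := A.hom.nat.app
                                       naturality := fun m m' f => A.hom.nat.naturality f }
    have hg' : ∀ m, g ⊵ₗ m ≫ e.app m = A.hom.nat.app m := fun m =>
      congrArg (fun ψ => ψ.app m) hg
    refine ⟨⟨g, couniversalCenter_comm h g fun X m => ?_⟩,
      ModuleEnd.Hom.ext (NatTrans.ext (funext hg'))⟩
    rw [hg', hg']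
    exact A.hom.comm X m
  refine (IsTerminal.ofUniqueHom (Y := CostructuredArrow.mk c)
    (fun A => CostructuredArrow.homMk (key A).choose (key A).choose_spec) fun A k => ?_).hasTerminal
  ext1
  have hk := (CostructuredArrow.w k).trans (key A).choose_spec.symm
  exact Center.ext _ _ (h.hom_ext fun m => congrArg (fun ψ => ψ.nat.app m) hk)

end RightAdjoint

section Existence
open MonoidalLeftAction
universe v₁ u₁ v₃ u₃
variable {C : Type u₁} [Category.{v₁} C] [Abelian C] [Linear ℂ C] [MonoidalCategory C]
variable {M : Type u₃} [Category.{v₃} M] [Abelian M] [Linear ℂ M] [MonoidalLeftAction C M]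
variable [BilinearAction C M]

instance actionFunctor_additive : (actionFunctor C M).Additive :=
  ⟨fun {_ _ f g} => NatTrans.ext (funext fun m => BilinearAction.add_left f g m)⟩

instance actionFunctor_linear : (actionFunctor C M).Linear ℂ :=
  ⟨fun f c => NatTrans.ext (funext fun m => BilinearAction.smul_left c f m)⟩

instance actionFunctor_obj_additive (V : C) : ((actionFunctor C M).obj V).Additive :=
  ⟨fun {_ _ f g} => BilinearAction.add_right V f g⟩

/-- The value of the right adjoint at `F` is an object of `C` representing the presheaf
`V ↦ Nat (V ⊙ -, F)`, with the half-braiding `couniversalBraid`. -/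
theorem centralAction_isLeftAdjoint [RigidCategory C] [IsFiniteSemisimple C]
    [IsFiniteSemisimple M] : (centralAction C M).IsLeftAdjoint := by
  have (F : ModuleEnd C M) : HasTerminal (CostructuredArrow (centralAction C M) F) := by
    obtain ⟨P, e, h⟩ := exists_isCouniversal (actionFunctor C M) F.functor
      fun V => finiteDimensional_natTrans _ _
    exact hasTerminal_costructuredArrow F h
  exact isLeftAdjoint_of_costructuredArrowTerminals _

end Existence

/-! ### The equivalence of Drinfeld centers induced by a monoidal equivalence -/

section Image
universe v₁ u₁ v₂ u₂
variable {C : Type u₁} [Category.{v₁} C] {D : Type u₂} [Category.{v₂} D] [MonoidalCategory D]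
variable (Φ : C ⥤ D)

/-- A morphism of the Drinfeld center of `D` only has to commute with the half-braidings with
objects in the image of an essentially surjective functor. -/
theorem center_comm_of_image [Φ.EssSurj] {V W : Center D} (f : V.1 ⟶ W.1)
    (h : ∀ X : C, f ▷ Φ.obj X ≫ (W.2.β (Φ.obj X)).hom = (V.2.β (Φ.obj X)).hom ≫ Φ.obj X ◁ f)
    (Y : D) : f ▷ Y ≫ (W.2.β Y).hom = (V.2.β Y).hom ≫ Y ◁ f := by
  rw [← cancel_epi (V.1 ◁ (Φ.objObjPreimageIso Y).hom), whisker_exchange_assoc, W.2.naturality,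
    V.2.naturality_assoc, ← whisker_exchange, reassoc_of% (h (Φ.objPreimage Y))]

end Image

section CenterFunctor
open Functor.LaxMonoidal Functor.OplaxMonoidal
universe v₁ u₁ v₂ u₂
variable {C : Type u₁} [Category.{v₁} C] [MonoidalCategory C]
variable {D : Type u₂} [Category.{v₂} D] [MonoidalCategory D] (Φ : C ⥤ D) [Φ.Monoidal]

/-- The image under `Φ` of the half-braiding of `V` with `X`. -/
def mapBraid (V : Center C) (X : C) : Φ.obj V.1 ⊗ Φ.obj X ≅ Φ.obj X ⊗ Φ.obj V.1 :=
  Functor.Monoidal.μIso Φ V.1 X ≪≫ Φ.mapIso (V.2.β X) ≪≫ (Functor.Monoidal.μIso Φ X V.1).symm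

theorem mapBraid_hom (V : Center C) (X : C) :
    (mapBraid Φ V X).hom = μ Φ V.1 X ≫ Φ.map (V.2.β X).hom ≫ δ Φ X V.1 := rfl

theorem mapBraid_inv (V : Center C) (X : C) :
    (mapBraid Φ V X).inv = μ Φ X V.1 ≫ Φ.map (V.2.β X).inv ≫ δ Φ V.1 X := by
  simp [mapBraid]

theorem mapBraid_naturality (V : Center C) {X Y : C} (f : X ⟶ Y) :
    Φ.obj V.1 ◁ Φ.map f ≫ (mapBraid Φ V Y).hom = (mapBraid Φ V X).hom ≫ Φ.map f ▷ Φ.obj V.1 := by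
  rw [mapBraid_hom, mapBraid_hom, μ_natural_right_assoc, ← Φ.map_comp_assoc, V.2.naturality,
    Φ.map_comp_assoc]
  simp

theorem mapBraid_tensor (V : Center C) (X Y : C) :
    Φ.obj V.1 ◁ μ Φ X Y ≫ (mapBraid Φ V (X ⊗ Y)).hom = (α_ _ _ _).inv ≫
      (mapBraid Φ V X).hom ▷ Φ.obj Y ≫ (α_ _ _ _).hom ≫ Φ.obj X ◁ (mapBraid Φ V Y).hom ≫
      (α_ _ _ _).inv ≫ μ Φ X Y ▷ Φ.obj V.1 := by
  rw [mapBraid_hom, V.2.monoidal]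
  simp only [Φ.map_comp, mapBraid_hom, comp_whiskerRight, MonoidalCategory.whiskerLeft_comp,
    Functor.Monoidal.map_associator, Functor.Monoidal.map_associator_inv,
    Functor.Monoidal.map_whiskerLeft, Functor.Monoidal.map_whiskerRight, Category.assoc]
  simp only [Functor.Monoidal.μ_δ_assoc, Functor.Monoidal.μ_δ,
    Functor.Monoidal.whiskerLeft_μ_δ_assoc, Category.comp_id]

variable [Φ.IsEquivalence]

/-- The half-braiding of `Φ V` with an arbitrary object of `D`, transported from an object in the
image of `Φ`. -/
def transportBraid (V : Center C) (Y : D) : Φ.obj V.1 ⊗ Y ≅ Y ⊗ Φ.obj V.1 :=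
  whiskerLeftIso _ (Φ.objObjPreimageIso Y).symm ≪≫ mapBraid Φ V (Φ.objPreimage Y) ≪≫
    whiskerRightIso (Φ.objObjPreimageIso Y) _

/-- The transported half-braiding does not depend on how `Y` is presented as an object in the image
of `Φ`: it is compatible with any morphism `Φ X ⟶ Y`. -/
theorem transportBraid_hom (V : Center C) {X : C} {Y : D} (f : Φ.obj X ⟶ Y) :
    Φ.obj V.1 ◁ f ≫ (transportBraid Φ V Y).hom = (mapBraid Φ V X).hom ≫ f ▷ Φ.obj V.1 := by
  have h := mapBraid_naturality Φ V (Φ.preimage (f ≫ (Φ.objObjPreimageIso Y).inv))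
  rw [Φ.map_preimage] at h
  have h' := h =≫ (Φ.objObjPreimageIso Y).hom ▷ _
  simp only [Category.assoc, ← comp_whiskerRight, Iso.inv_hom_id, Category.comp_id] at h'
  rw [← h']
  simp [transportBraid]

theorem transportBraid_obj (V : Center C) (X : C) :
    transportBraid Φ V (Φ.obj X) = mapBraid Φ V X := by
  ext
  simpa using transportBraid_hom Φ V (𝟙 (Φ.obj X))

/-- The object `Φ V` of the Drinfeld center of `D`, with the transported half-braiding. -/
def centerObj (V : Center C) : Center D :=
  ⟨Φ.obj V.1,
    { β := transportBraid Φ V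
      naturality := fun {Y Y'} f => by
        rw [← cancel_epi (Φ.obj V.1 ◁ (Φ.objObjPreimageIso Y).hom),
          ← MonoidalCategory.whiskerLeft_comp_assoc, transportBraid_hom, comp_whiskerRight,
          ← Category.assoc, ← Category.assoc, transportBraid_hom]
      monoidal := fun Y Y' => by
        set e := (Φ.objObjPreimageIso Y).hom
        set e' := (Φ.objObjPreimageIso Y').hom
        have h := Φ.obj V.1 ◁ μ Φ _ _ ≫= transportBraid_hom Φ V (δ Φ _ _ ≫ (e ⊗ₘ e'))
        rw [reassoc_of% mapBraid_tensor] at h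
        simp only [← MonoidalCategory.whiskerLeft_comp_assoc, ← comp_whiskerRight,
          Functor.Monoidal.μ_δ_assoc] at h
        rw [← cancel_epi (Φ.obj V.1 ◁ (e ⊗ₘ e')), h]
        -- It remains to move `e` and `e'` past the two half-braidings on the other side.
        have h1 := transportBraid_hom Φ V e
        have h2 := transportBraid_hom Φ V e'
        symm
        calc _ = (α_ _ _ _).inv ≫ (Φ.obj V.1 ◁ e) ▷ _ ≫
              (_ ◁ e' ≫ (transportBraid Φ V Y).hom ▷ Y') ≫ (α_ _ _ _).hom ≫
              Y ◁ (transportBraid Φ V Y').hom ≫ (α_ _ _ _).inv := by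
                rw [MonoidalCategory.tensorHom_def]; monoidal
          _ = (α_ _ _ _).inv ≫ (Φ.obj V.1 ◁ e ≫ (transportBraid Φ V Y).hom) ▷ _ ≫
              (α_ _ _ _).hom ≫ Y ◁ (Φ.obj V.1 ◁ e' ≫ (transportBraid Φ V Y').hom) ≫
              (α_ _ _ _).inv := by
                rw [whisker_exchange]; monoidal
          _ = (α_ _ _ _).inv ≫ (mapBraid Φ V _).hom ▷ _ ≫ (α_ _ _ _).hom ≫
              (e ▷ _ ≫ Y ◁ (mapBraid Φ V _).hom) ≫ Y ◁ e' ▷ _ ≫ (α_ _ _ _).inv := by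
                rw [h1, h2]; monoidal
          _ = _ := by
                rw [← whisker_exchange, MonoidalCategory.tensorHom_def]; monoidal }⟩

theorem centerObj_braid (V : Center C) (X : C) :
    (centerObj Φ V).2.β (Φ.obj X) = mapBraid Φ V X := transportBraid_obj Φ V X

theorem mapBraid_comm_iff {V W : Center C} (f : V.1 ⟶ W.1) (X : C) :
    Φ.map f ▷ Φ.obj X ≫ (mapBraid Φ W X).hom = (mapBraid Φ V X).hom ≫ Φ.obj X ◁ Φ.map f ↔
      f ▷ X ≫ (W.2.β X).hom = (V.2.β X).hom ≫ X ◁ f := by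
  rw [mapBraid_hom, mapBraid_hom, μ_natural_left_assoc, Category.assoc, Category.assoc,
    δ_natural_right, cancel_epi, ← Category.assoc, ← Category.assoc, cancel_mono, ← Φ.map_comp,
    ← Φ.map_comp, Φ.map_injective.eq_iff]

/-- The functor between the Drinfeld centers induced by a monoidal equivalence. -/
def centerFunctor : Center C ⥤ Center D where
  obj V := centerObj Φ V
  map {V W} f :=
    { f := Φ.map f.f
      comm := center_comm_of_image Φ (V := centerObj Φ V) (W := centerObj Φ W) (Φ.map f.f)
        fun X => by
          rw [centerObj_braid, centerObj_braid]
          exact (mapBraid_comm_iff Φ f.f X).2 (f.comm X) }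
  map_id V := Center.ext _ _ (Φ.map_id V.1)
  map_comp f g := Center.ext _ _ (Φ.map_comp f.f g.f)

instance : (centerFunctor Φ).Faithful where
  map_injective h := Center.ext _ _ (Φ.map_injective (congrArg Center.Hom.f h))

instance : (centerFunctor Φ).Full where
  map_surjective {V W} g := by
    obtain ⟨k, hk⟩ := Φ.map_surjective (X := V.1) (Y := W.1) g.f
    refine ⟨⟨k, fun X => (mapBraid_comm_iff Φ k X).1 ?_⟩, Center.ext _ _ hk⟩
    have h : g.f ▷ Φ.obj X ≫ ((centerObj Φ W).2.β (Φ.obj X)).hom =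
      ((centerObj Φ V).2.β (Φ.obj X)).hom ≫ Φ.obj X ◁ g.f := g.comm (Φ.obj X)
    rw [centerObj_braid, centerObj_braid] at h
    rw [hk]
    exact h

section Preimage
variable (W : Center D) {V : C} (i : Φ.obj V ≅ W.1)

/-- The half-braiding of `W` with `Φ X`, lifted along `i : Φ V ≅ W`. -/
def preimageBraid (X : C) : V ⊗ X ≅ X ⊗ V :=
  Φ.preimageIso ((Functor.Monoidal.μIso Φ V X).symm ≪≫ whiskerRightIso i (Φ.obj X) ≪≫
    W.2.β (Φ.obj X) ≪≫ whiskerLeftIso (Φ.obj X) i.symm ≪≫ Functor.Monoidal.μIso Φ X V)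

theorem map_preimageBraid (X : C) : Φ.map (preimageBraid Φ W i X).hom =
    δ Φ V X ≫ i.hom ▷ Φ.obj X ≫ (W.2.β (Φ.obj X)).hom ≫ Φ.obj X ◁ i.inv ≫ μ Φ X V := by
  simp [preimageBraid]

/-- The object `V` with the half-braiding of `W` lifted along `i : Φ V ≅ W`. -/
def centerPreimage : Center C :=
  ⟨V, { β := preimageBraid Φ W i
        naturality := fun {X Y} f => Φ.map_injective (by
          have h := W.2.naturality (Φ.map f)
          rw [Φ.map_comp, Φ.map_comp, map_preimageBraid, map_preimageBraid,
            ← δ_natural_right_assoc, whisker_exchange_assoc, reassoc_of% h]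
          simp only [Category.assoc, ← μ_natural_left, ← whisker_exchange_assoc])
        monoidal := fun X Y => Φ.map_injective (by
          have h := W.2.naturality (δ Φ X Y)
          have h' : (W.2.β (Φ.obj (X ⊗ Y))).hom = W.1 ◁ δ Φ X Y ≫
              (W.2.β (Φ.obj X ⊗ Φ.obj Y)).hom ≫ μ Φ X Y ▷ W.1 := by
            rw [reassoc_of% h, ← comp_whiskerRight]; simp
          rw [map_preimageBraid, h', W.2.monoidal]
          simp only [Φ.map_comp, comp_whiskerRight, MonoidalCategory.whiskerLeft_comp,
            Functor.Monoidal.map_associator, Functor.Monoidal.map_associator_inv,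
            Functor.Monoidal.map_whiskerLeft, Functor.Monoidal.map_whiskerRight, Category.assoc,
            map_preimageBraid]
          simp only [Functor.Monoidal.μ_δ_assoc, Functor.Monoidal.whiskerLeft_μ_δ_assoc,
            Functor.Monoidal.whiskerRight_μ_δ_assoc]
          rw [← whisker_exchange_assoc]
          congr 2
          rw [← whisker_exchange_assoc]
          have e1 : (Φ.obj X ◁ i.inv) ▷ Φ.obj Y ≫ (α_ _ _ _).hom ≫ Φ.obj X ◁ i.hom ▷ Φ.obj Y =
              (α_ _ _ _).hom := by
            rw [whisker_assoc, Category.assoc, Category.assoc, Iso.inv_hom_id_assoc,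
              ← MonoidalCategory.whiskerLeft_comp, ← comp_whiskerRight]
            simp
          rw [reassoc_of% e1]
          simp) }⟩

theorem mapBraid_centerPreimage (X : C) :
    i.hom ▷ Φ.obj X ≫ (W.2.β (Φ.obj X)).hom =
      (mapBraid Φ (centerPreimage Φ W i) X).hom ≫ Φ.obj X ◁ i.hom := by
  rw [mapBraid_hom]
  change _ = (μ Φ V X ≫ Φ.map (preimageBraid Φ W i X).hom ≫ δ Φ X V) ≫ Φ.obj X ◁ i.hom
  rw [map_preimageBraid]
  simp only [Category.assoc, Functor.Monoidal.μ_δ, Functor.Monoidal.μ_δ_assoc, Category.comp_id,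
    ← MonoidalCategory.whiskerLeft_comp, Iso.inv_hom_id, MonoidalCategory.whiskerLeft_id]

end Preimage

instance : (centerFunctor Φ).EssSurj where
  mem_essImage W := by
    let i := Φ.objObjPreimageIso W.1
    let f : (centerFunctor Φ).obj (centerPreimage Φ W i) ⟶ W :=
      { f := i.hom
        comm := center_comm_of_image Φ (V := centerObj Φ (centerPreimage Φ W i)) i.hom fun X => by
          rw [centerObj_braid]
          exact mapBraid_centerPreimage Φ W i X }
    have : IsIso f.f := inferInstanceAs (IsIso i.hom)
    exact ⟨_, ⟨Center.isoMk f⟩⟩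

instance : (centerFunctor Φ).IsEquivalence where

end CenterFunctor

/-! ### Comparison of the central actions and of their adjoints -/

section ModuleImage
open MonoidalLeftAction Functor.LaxLeftLinear
universe v₁ u₁ v₂ u₂ v₃ u₃
variable {C : Type u₁} [Category.{v₁} C] {D : Type u₂} [Category.{v₂} D] [MonoidalCategory D]
variable (Φ : C ⥤ D)
variable (M : Type u₃) [Category.{v₃} M] [Abelian M] [Linear ℂ M] [MonoidalLeftAction D M]

/-- A transformation compatible with the module structures at the objects `Φ X` is compatible with
them at all objects, as `Φ` is essentially surjective. -/
theorem moduleHom_comm_of_image [Φ.EssSurj] {F G : ModuleEnd D M} (f : F.functor ⟶ G.functor)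
    (h : ∀ (X : C) (m : M), Φ.obj X ⊴ₗ f.app m ≫ μₗ G.functor (Φ.obj X) m =
      μₗ F.functor (Φ.obj X) m ≫ f.app (Φ.obj X ⊙ₗ m)) (Y : D) (m : M) :
    Y ⊴ₗ f.app m ≫ μₗ G.functor Y m = μₗ F.functor Y m ≫ f.app (Y ⊙ₗ m) := by
  let k := (Φ.objObjPreimageIso Y).hom
  have hk : IsIso (k ⊵ₗ F.functor.obj m) := by
    refine ⟨(Φ.objObjPreimageIso Y).inv ⊵ₗ F.functor.obj m, ?_, ?_⟩ <;>
    simp [k, ← comp_actionHomLeft]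
  rw [← cancel_epi (k ⊵ₗ F.functor.obj m), ← action_exchange_assoc, μₗ_naturality_left,
    reassoc_of% (h _ m), ← f.naturality, ← μₗ_naturality_left_assoc]

end ModuleImage

section RestrictedBraiding
open MonoidalLeftAction Functor.LaxMonoidal Functor.OplaxMonoidal
universe v₁ u₁ v₂ u₂ v₃ u₃
variable {C : Type u₁} [Category.{v₁} C] [MonoidalCategory C]
variable {D : Type u₂} [Category.{v₂} D] [MonoidalCategory D]
variable (Φ : C ⥤ D) [Φ.Monoidal] [Φ.IsEquivalence]
variable (M : Type u₃) [Category.{v₃} M] [MonoidalLeftAction D M]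

/-- The module structure of `V ⊙ -` for the restricted action is that of `Φ V ⊙ -`. -/
theorem restrictAction_actMu (V : Center C) (X : C) (m : M) :
    @actMu C _ _ M _ (restrictAction Φ M) _ V.2 X m =
      actMu ((centerFunctor Φ).obj V).2 (Φ.obj X) m := by
  change ((αₗ (Φ.obj X) (Φ.obj V.1) m).inv ≫ μ Φ X V.1 ⊵ₗ m) ≫ Φ.map (V.2.β X).inv ⊵ₗ m ≫
    δ Φ V.1 X ⊵ₗ m ≫ (αₗ (Φ.obj V.1) (Φ.obj X) m).hom = (αₗ (Φ.obj X) (Φ.obj V.1) m).inv ≫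
      ((centerObj Φ V).2.β (Φ.obj X)).inv ⊵ₗ m ≫ (αₗ (Φ.obj V.1) (Φ.obj X) m).hom
  have e : (mapBraid Φ V X).inv ⊵ₗ m =
      μ Φ X V.1 ⊵ₗ m ≫ Φ.map (V.2.β X).inv ⊵ₗ m ≫ δ Φ V.1 X ⊵ₗ m := by
    rw [mapBraid_inv, comp_actionHomLeft, comp_actionHomLeft]
  rw [centerObj_braid]
  refine Eq.trans ?_ (congrArg (fun t => (αₗ (Φ.obj X) (Φ.obj V.1) m).inv ≫ t ≫
    (αₗ (Φ.obj V.1) (Φ.obj X) m).hom) e).symm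
  simp only [Category.assoc]

end RestrictedBraiding

section Comparison
open MonoidalLeftAction Functor.LaxLeftLinear Functor.LaxMonoidal Functor.OplaxMonoidal
universe v₁ u₁ v₂ u₂ v₃ u₃
variable {C : Type u₁} [Category.{v₁} C] [MonoidalCategory C] [Preadditive C] [Linear ℂ C]
variable {D : Type u₂} [Category.{v₂} D] [MonoidalCategory D] [Preadditive D] [Linear ℂ D]
variable (Φ : C ⥤ D) [Φ.Monoidal] [Φ.IsEquivalence]
variable (M : Type u₃) [Category.{v₃} M] [Abelian M] [Linear ℂ M] [MonoidalLeftAction D M]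

/-- The functor `Φ*` is fully faithful. -/
def dualFunctorFullyFaithful :
    letI : MonoidalLeftAction C M := restrictAction Φ M
    (dualFunctor Φ M).FullyFaithful :=
  letI : MonoidalLeftAction C M := restrictAction Φ M
  { preimage := fun f => ⟨f.nat, moduleHom_comm_of_image Φ M f.nat f.comm⟩
    map_preimage := fun _ => rfl
    preimage_map := fun _ => rfl }

variable [RigidCategory C] [RigidCategory D] [Φ.Additive] [Φ.Linear ℂ] [BilinearAction D M]

/-- The central action of `C` on `M` is obtained from the one of `D`: the components of this
isomorphism are identities. -/
def centralActionIso :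
    letI : MonoidalLeftAction C M := restrictAction Φ M
    centralAction C M ≅ (centerFunctor Φ ⋙ centralAction D M) ⋙ dualFunctor Φ M :=
  letI : MonoidalLeftAction C M := restrictAction Φ M
  NatIso.ofComponents (fun V =>
    { hom := { nat := { app := fun m => 𝟙 (Φ.obj V.1 ⊙ₗ m)
                        naturality := fun _ _ _ =>
                          (Category.comp_id _).trans (Category.id_comp _).symm }
               comm := fun X m => (congrArg (· ≫ _) (actionHomRight_id (Φ.obj X) _)).trans
                 ((Category.id_comp _).trans
                   ((restrictAction_actMu Φ M V X m).symm.trans (Category.comp_id _).symm)) }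
      inv := { nat := { app := fun m => 𝟙 (Φ.obj V.1 ⊙ₗ m)
                        naturality := fun _ _ _ =>
                          (Category.comp_id _).trans (Category.id_comp _).symm }
               comm := fun X m => (congrArg (· ≫ _) (actionHomRight_id (Φ.obj X) _)).trans
                 ((Category.id_comp _).trans
                   ((restrictAction_actMu Φ M V X m).trans (Category.comp_id _).symm)) }
      hom_inv_id := ModuleEnd.Hom.ext (NatTrans.ext (funext fun _ => Category.comp_id _))
      inv_hom_id := ModuleEnd.Hom.ext (NatTrans.ext (funext fun _ => Category.comp_id _)) })
    fun _ => ModuleEnd.Hom.ext (NatTrans.ext (funext fun _ =>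
      (Category.comp_id _).trans (Category.id_comp _).symm))

/-- Under `centerFunctor Φ`, right adjoints of the central actions of `C` and `D` correspond. -/
theorem nonempty_iso_of_rightAdjoint :
    letI : MonoidalLeftAction C M := restrictAction Φ M
    ∀ (K : ModuleEnd C M ⥤ Center C) (K' : ModuleEnd D M ⥤ Center D)
      (_ : centralAction C M ⊣ K) (_ : centralAction D M ⊣ K') (F : ModuleEnd D M),
      Nonempty ((centerFunctor Φ).obj (K.obj ((dualFunctor Φ M).obj F)) ≅ K'.obj F) := by
  let : MonoidalLeftAction C M := restrictAction Φ M
  intro K K' adj adj' F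
  -- As `Φ*` is fully faithful, cancelling it turns `adj` into an adjunction for the central action
  -- of `D`, precomposed with `centerFunctor Φ`.
  have a1 : centerFunctor Φ ⋙ centralAction D M ⊣ dualFunctor Φ M ⋙ K :=
    adj.restrictFullyFaithful (.id _) (dualFunctorFullyFaithful Φ M)
      (Functor.leftUnitor _ ≪≫ centralActionIso Φ M) (Functor.rightUnitor _).symm
  -- The other right adjoint of the same functor is `K'` followed by the inverse of the equivalence.
  have a2 := (centerFunctor Φ).asEquivalence.toAdjunction.comp adj'
  exact ⟨(centerFunctor Φ).mapIso ((a1.rightAdjointUniq a2).app F) ≪≫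
    (centerFunctor Φ).asEquivalence.counitIso.app (K'.obj F)⟩

/-- Under `centerFunctor Φ`, left adjoints of the central actions of `C` and `D` correspond. -/
theorem nonempty_iso_of_leftAdjoint :
    letI : MonoidalLeftAction C M := restrictAction Φ M
    ∀ (K : ModuleEnd C M ⥤ Center C) (K' : ModuleEnd D M ⥤ Center D)
      (_ : K ⊣ centralAction C M) (_ : K' ⊣ centralAction D M) (F : ModuleEnd D M),
      Nonempty ((centerFunctor Φ).obj (K.obj ((dualFunctor Φ M).obj F)) ≅ K'.obj F) := by
  let : MonoidalLeftAction C M := restrictAction Φ M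
  intro K K' adj adj' F
  have a1 : dualFunctor Φ M ⋙ K ⊣ centerFunctor Φ ⋙ centralAction D M :=
    adj.restrictFullyFaithful (dualFunctorFullyFaithful Φ M) (.id _)
      (Functor.rightUnitor _).symm (Functor.leftUnitor _ ≪≫ centralActionIso Φ M)
  have a2 := adj'.comp (centerFunctor Φ).asEquivalence.symm.toAdjunction
  exact ⟨(centerFunctor Φ).mapIso ((a1.leftAdjointUniq a2).app F) ≪≫
    (centerFunctor Φ).asEquivalence.counitIso.app (K'.obj F)⟩

end Comparison

/-! ### The Drinfeld morphism -/

section Pairing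
universe v u
variable {C : Type u} [Category.{v} C] [MonoidalCategory C]

/-- A morphism into a dual is determined by its pairing with the original object. -/
theorem hom_rightDual_ext {X Y : C} [HasRightDual Y] {f g : X ⟶ Y✶}
    (h : f ▷ Y ≫ ε_ Y Y✶ = g ▷ Y ≫ ε_ Y Y✶) : f = g := by
  have e (k : X ⟶ Y✶) : (tensorRightHomEquiv X Y Y✶ (𝟙_ C)) (k ▷ Y ≫ ε_ Y Y✶) = k ≫ (λ_ _).inv :=
    tensorRightHomEquiv_whiskerRight_comp_evaluation k
  rw [← cancel_mono (λ_ Y✶).inv, ← e, ← e, h]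

variable [RigidCategory C]

/-- Up to the half-braiding, the Drinfeld morphism is the pairing `ev_V`. -/
theorem drinfeld_pairing (V : Center C) :
    drinfeld V ▷ V.1✶ ≫ ε_ V.1✶ V.1✶✶ = (V.2.β V.1✶).hom ≫ ε_ V.1 V.1✶ := by
  have e : drinfeld V = (ρ_ V.1).inv ≫ V.1 ◁ η_ V.1✶ V.1✶✶ ≫ (α_ _ _ _).inv ≫
      ((V.2.β V.1✶).hom ≫ ε_ V.1 V.1✶) ▷ V.1✶✶ ≫ (λ_ _).hom := by
    have := coev_halfBraiding V =≫ ((α_ _ _ _).inv ≫ ε_ V.1 V.1✶ ▷ V.1✶✶ ≫ (λ_ V.1✶✶).hom)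
    simp only [Category.assoc] at this
    rw [drinfeld, this]
    simp
  set b := (V.2.β V.1✶).hom ≫ ε_ V.1 V.1✶
  rw [e]
  calc _ = 𝟙 _ ⊗≫ V.1 ◁ η_ V.1✶ V.1✶✶ ▷ V.1✶ ⊗≫
        (b ▷ (V.1✶✶ ⊗ V.1✶) ≫ 𝟙_ C ◁ ε_ V.1✶ V.1✶✶) ⊗≫ 𝟙 _ := by monoidal
    _ = 𝟙 _ ⊗≫ V.1 ◁ (η_ V.1✶ V.1✶✶ ▷ V.1✶ ⊗≫ V.1✶ ◁ ε_ V.1✶ V.1✶✶) ⊗≫ b := by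
        rw [← whisker_exchange]; monoidal
    _ = _ := by rw [ExactPairing.evaluation_coevaluation'']; monoidal

/-- The Drinfeld morphism is natural on the center. -/
theorem drinfeld_naturality {V W : Center C} (f : V ⟶ W) :
    f.f ≫ drinfeld W = drinfeld V ≫ rightAdjointMate (rightAdjointMate f.f) := by
  refine hom_rightDual_ext ?_
  rw [comp_whiskerRight, comp_whiskerRight, Category.assoc, Category.assoc, drinfeld_pairing,
    rightAdjointMate_comp_evaluation, ← whisker_exchange_assoc, drinfeld_pairing,
    V.2.naturality_assoc, rightAdjointMate_comp_evaluation, ← Category.assoc, f.comm,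
    Category.assoc]

end Pairing

/-! ### Duals and the Drinfeld morphism under a monoidal functor -/

section Duality
open Functor.LaxMonoidal Functor.OplaxMonoidal
universe v₁ u₁ v₂ u₂
variable {C : Type u₁} [Category.{v₁} C] [MonoidalCategory C] [RigidCategory C]
variable {D : Type u₂} [Category.{v₂} D] [MonoidalCategory D]
variable (Φ : C ⥤ D) [Φ.Monoidal]

/-- The image of the evaluation of `X` under `Φ`. -/
def mapEv (X : C) : Φ.obj X✶ ⊗ Φ.obj X ⟶ 𝟙_ D := μ Φ X✶ X ≫ Φ.map (ε_ X X✶) ≫ η Φ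

/-- The image of the coevaluation of `X` under `Φ`. -/
def mapCoev (X : C) : 𝟙_ D ⟶ Φ.obj X ⊗ Φ.obj X✶ := ε Φ ≫ Φ.map (η_ X X✶) ≫ δ Φ X X✶

theorem mapCoev_mapEv (X : C) :
    mapCoev Φ X ▷ Φ.obj X ≫ (α_ _ _ _).hom ≫ Φ.obj X ◁ mapEv Φ X = (λ_ _).hom ≫ (ρ_ _).inv := by
  have h := congrArg (fun f => ε Φ ▷ Φ.obj X ≫ μ Φ (𝟙_ C) X ≫ Φ.map f ≫ δ Φ X (𝟙_ C) ≫
    Φ.obj X ◁ η Φ) (ExactPairing.evaluation_coevaluation X X✶)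
  simp only [Φ.map_comp, Functor.Monoidal.map_associator, Functor.Monoidal.map_whiskerLeft,
    Functor.Monoidal.map_whiskerRight, Functor.Monoidal.map_leftUnitor,
    Functor.Monoidal.map_rightUnitor_inv, Category.assoc, Functor.Monoidal.μ_δ_assoc,
    Functor.Monoidal.whiskerRight_ε_η_assoc, Functor.Monoidal.whiskerLeft_ε_η,
    Category.comp_id] at h
  simp only [mapCoev, mapEv, comp_whiskerRight, MonoidalCategory.whiskerLeft_comp, Category.assoc]
  exact h

theorem mapEv_mapCoev (X : C) :
    Φ.obj X✶ ◁ mapCoev Φ X ≫ (α_ _ _ _).inv ≫ mapEv Φ X ▷ Φ.obj X✶ =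
      (ρ_ _).hom ≫ (λ_ _).inv := by
  have h := congrArg (fun f => Φ.obj X✶ ◁ ε Φ ≫ μ Φ X✶ (𝟙_ C) ≫ Φ.map f ≫ δ Φ (𝟙_ C) X✶ ≫
    η Φ ▷ Φ.obj X✶) (ExactPairing.coevaluation_evaluation X X✶)
  simp only [Φ.map_comp, Functor.Monoidal.map_associator_inv, Functor.Monoidal.map_whiskerLeft,
    Functor.Monoidal.map_whiskerRight, Functor.Monoidal.map_rightUnitor,
    Functor.Monoidal.map_leftUnitor_inv, Category.assoc, Functor.Monoidal.μ_δ_assoc,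
    Functor.Monoidal.whiskerLeft_ε_η_assoc, Functor.Monoidal.whiskerRight_ε_η,
    Category.comp_id] at h
  simp only [mapCoev, mapEv, comp_whiskerRight, MonoidalCategory.whiskerLeft_comp, Category.assoc]
  exact h

/-- The image of the duality pairing of `X` and `X*` under a monoidal functor. -/
@[reducible]
def mapExactPairing (X : C) : ExactPairing (Φ.obj X) (Φ.obj X✶) where
  coevaluation' := mapCoev Φ X
  evaluation' := mapEv Φ X
  coevaluation_evaluation' := mapEv_mapCoev Φ X
  evaluation_coevaluation' := mapCoev_mapEv Φ X

variable [RigidCategory D]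

/-- The defining property of `dualityTransform`: it carries the evaluation of `Φ X` to the image of
the evaluation of `X`. -/
theorem dualityTransform_ev (X : C) :
    dualityTransform Φ X ▷ Φ.obj X ≫ ε_ (Φ.obj X) (Φ.obj X)✶ = mapEv Φ X := by
  have e : dualityTransform Φ X = (ρ_ (Φ.obj X✶)).inv ≫ Φ.obj X✶ ◁ η_ (Φ.obj X) (Φ.obj X)✶ ≫
      (α_ _ _ _).inv ≫ mapEv Φ X ▷ (Φ.obj X)✶ ≫ (λ_ (Φ.obj X)✶).hom := rfl
  rw [e]
  calc _ = 𝟙 _ ⊗≫ Φ.obj X✶ ◁ η_ (Φ.obj X) (Φ.obj X)✶ ▷ Φ.obj X ⊗≫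
        (mapEv Φ X ▷ ((Φ.obj X)✶ ⊗ Φ.obj X) ≫ 𝟙_ D ◁ ε_ (Φ.obj X) (Φ.obj X)✶) ⊗≫ 𝟙 _ := by
          monoidal
    _ = 𝟙 _ ⊗≫ Φ.obj X✶ ◁ (η_ (Φ.obj X) (Φ.obj X)✶ ▷ Φ.obj X ⊗≫
          Φ.obj X ◁ ε_ (Φ.obj X) (Φ.obj X)✶) ⊗≫ mapEv Φ X := by
        rw [← whisker_exchange]; monoidal
    _ = _ := by rw [ExactPairing.evaluation_coevaluation'']; monoidal

/-- `dualityTransform` is the comparison of the two right duals `Φ(X*)` and `Φ(X)*` of `Φ X`. -/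
theorem dualityTransform_isIso (X : C) : IsIso (dualityTransform Φ X) := by
  let p : ExactPairing (Φ.obj X) (Φ.obj X)✶ := inferInstance
  have h : dualityTransform Φ X = (rightDualIso (mapExactPairing Φ X) p).hom := by
    change _ = (ρ_ (Φ.obj X✶)).inv ≫ Φ.obj X✶ ◁ η_ (Φ.obj X) (Φ.obj X)✶ ≫
      Φ.obj X✶ ◁ 𝟙 (Φ.obj X) ▷ (Φ.obj X)✶ ≫ (α_ _ _ _).inv ≫ mapEv Φ X ▷ (Φ.obj X)✶ ≫
      (λ_ (Φ.obj X)✶).hom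
    rw [id_whiskerRight, MonoidalCategory.whiskerLeft_id, Category.id_comp]
    rfl
  rw [h]
  infer_instance

/-- `dualityTransform` carries the image of the coevaluation of `X` to the coevaluation of `Φ X`. -/
theorem dualityTransform_coev (X : C) :
    mapCoev Φ X ≫ Φ.obj X ◁ dualityTransform Φ X = η_ (Φ.obj X) (Φ.obj X)✶ := by
  have e : dualityTransform Φ X = (ρ_ (Φ.obj X✶)).inv ≫ Φ.obj X✶ ◁ η_ (Φ.obj X) (Φ.obj X)✶ ≫
      (α_ _ _ _).inv ≫ mapEv Φ X ▷ (Φ.obj X)✶ ≫ (λ_ (Φ.obj X)✶).hom := rfl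
  have t : mapCoev Φ X ▷ Φ.obj X ⊗≫ Φ.obj X ◁ mapEv Φ X = (λ_ _).hom ≫ (ρ_ _).inv := by
    rw [← mapCoev_mapEv]; monoidal
  rw [e]
  calc _ = 𝟙 _ ⊗≫ (mapCoev Φ X ▷ 𝟙_ D ≫ _ ◁ η_ (Φ.obj X) (Φ.obj X)✶) ⊗≫
        Φ.obj X ◁ mapEv Φ X ▷ (Φ.obj X)✶ ⊗≫ 𝟙 _ := by monoidal
    _ = η_ (Φ.obj X) (Φ.obj X)✶ ⊗≫ (mapCoev Φ X ▷ Φ.obj X ⊗≫ Φ.obj X ◁ mapEv Φ X) ▷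
        (Φ.obj X)✶ ⊗≫ 𝟙 _ := by rw [← whisker_exchange]; monoidal
    _ = _ := by rw [t]; monoidal

/-- The isomorphism between the image of the dual and the dual of the image. -/
def dualityIso (X : C) : Φ.obj X✶ ≅ (Φ.obj X)✶ :=
  have := dualityTransform_isIso Φ X
  asIso (dualityTransform Φ X)

variable [Φ.IsEquivalence]

/-- A monoidal equivalence maps Drinfeld morphisms to Drinfeld morphisms, up to the canonical
isomorphism of the double duals. Both sides have the same pairing with `Φ(V*)`, namely the image of
`ev_V`, up to the half-braiding. -/
theorem map_drinfeld (V : Center C) :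
    Φ.map (drinfeld V) ≫ dualityTransform Φ V.1✶ =
      drinfeld ((centerFunctor Φ).obj V) ≫ rightAdjointMate (dualityTransform Φ V.1) := by
  refine hom_rightDual_ext ?_
  have h1 : Φ.map (drinfeld V) ▷ Φ.obj V.1✶ ≫ mapEv Φ V.1✶ =
      (mapBraid Φ V V.1✶).hom ≫ mapEv Φ V.1 := by
    rw [mapEv, mapEv, mapBraid_hom, μ_natural_left_assoc, ← Φ.map_comp_assoc, drinfeld_pairing]
    simp
  -- Stated for an arbitrary `u` in place of the Drinfeld morphism of `Φ V`, whose source is `Φ V.1`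
  -- only after unfolding `centerFunctor`.
  have h2 (u : Φ.obj V.1 ⟶ (Φ.obj V.1)✶✶) (hu : u ▷ (Φ.obj V.1)✶ ≫ ε_ (Φ.obj V.1)✶ _ =
      (transportBraid Φ V (Φ.obj V.1)✶).hom ≫ ε_ (Φ.obj V.1) _) :
      (u ≫ rightAdjointMate (dualityTransform Φ V.1)) ▷ Φ.obj V.1✶ ≫ ε_ (Φ.obj V.1✶) _ =
        (mapBraid Φ V V.1✶).hom ≫ mapEv Φ V.1 := by
    rw [comp_whiskerRight, Category.assoc, rightAdjointMate_comp_evaluation,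
      ← whisker_exchange_assoc, hu, reassoc_of% transportBraid_hom, dualityTransform_ev]
  rw [comp_whiskerRight, Category.assoc, dualityTransform_ev, h1]
  exact (h2 _ (drinfeld_pairing (centerObj Φ V))).symm

end Duality

/-! ### The twist -/

section Twist
universe v u
variable {C : Type u} [Category.{v} C] [MonoidalCategory C] [RigidCategory C]

/-- An isomorphism of objects induces an isomorphism of their duals. -/
def rightDualMapIso {X Y : C} (i : X ≅ Y) : X✶ ≅ Y✶ where
  hom := rightAdjointMate i.inv
  inv := rightAdjointMate i.hom
  hom_inv_id := by rw [← comp_rightAdjointMate, i.hom_inv_id, rightAdjointMate_id]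
  inv_hom_id := by rw [← comp_rightAdjointMate, i.inv_hom_id, rightAdjointMate_id]

variable (j : PivotalStructure C)

theorem twist_comp_drinfeld (V : Center C) : twist j V ≫ drinfeld V = (j.iso V.1).hom := by
  simp [twist]

theorem twist_naturality {V W : Center C} (f : V ⟶ W) : twist j V ≫ f.f = f.f ≫ twist j W := by
  rw [← cancel_mono (drinfeld W), Category.assoc, Category.assoc, drinfeld_naturality,
    twist_comp_drinfeld, ← Category.assoc, twist_comp_drinfeld, j.naturality]

/-- Powers of the twist are natural on the center. -/
theorem twist_pow_naturality {V W : Center C} (f : V ⟶ W) (n : ℕ) :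
    (twist j V ^ n : End V.1) ≫ f.f = f.f ≫ (twist j W ^ n : End W.1) := by
  induction n with
  | zero => exact (Category.id_comp _).trans (Category.comp_id _).symm
  | succ n ih =>
    rw [pow_succ, pow_succ, End.mul_def, End.mul_def, Category.assoc, ih, ← Category.assoc,
      twist_naturality, Category.assoc]

end Twist

section MapTwist
universe v₁ u₁ v₂ u₂
variable {C : Type u₁} [Category.{v₁} C] [MonoidalCategory C] [RigidCategory C]
variable {D : Type u₂} [Category.{v₂} D] [MonoidalCategory D] [RigidCategory D]
variable (Φ : C ⥤ D) [Φ.Monoidal] {jC : PivotalStructure C} {jD : PivotalStructure D}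

/-- A pivotal monoidal equivalence preserves the twist of the Drinfeld center. -/
theorem map_twist [Φ.IsEquivalence] (hΦ : PreservesPivotal Φ jC jD) (V : Center C) :
    Φ.map (twist jC V) = twist jD ((centerFunctor Φ).obj V) := by
  have i1 := dualityTransform_isIso Φ V.1
  have i2 : IsIso (rightAdjointMate (dualityTransform Φ V.1)) :=
    (rightDualMapIso (dualityIso Φ V.1)).isIso_inv
  -- Stated for an arbitrary `u` in place of the Drinfeld morphism of `Φ V`, whose source is `Φ V.1`
  -- only after unfolding `centerFunctor`.
  have h (u : Φ.obj V.1 ⟶ (Φ.obj V.1)✶✶) (_ : IsIso u) (t : Φ.obj V.1 ⟶ Φ.obj V.1)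
      (hu : Φ.map (drinfeld V) ≫ dualityTransform Φ V.1✶ =
        u ≫ rightAdjointMate (dualityTransform Φ V.1)) (ht : t ≫ u = (jD.iso (Φ.obj V.1)).hom) :
      Φ.map (twist jC V) = t := by
    rw [← cancel_mono u, ht, ← cancel_mono (rightAdjointMate (dualityTransform Φ V.1)), ← hΦ,
      Category.assoc, ← hu, ← Φ.map_comp_assoc, twist_comp_drinfeld]
  exact h _ (drinfeld_isIso (centerObj Φ V)) _ (map_drinfeld Φ V)
    (twist_comp_drinfeld jD (centerObj Φ V))

end MapTwist

/-! ### Pivotal traces and the global dimension -/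

section EndScalar
universe v u
variable {C : Type u} [Category.{v} C] [Abelian C] [Linear ℂ C] [MonoidalCategory C] [IsFusion C]

theorem endScalar_smul (e : 𝟙_ C ⟶ 𝟙_ C) : endScalar e • 𝟙 (𝟙_ C) = e :=
  (endomorphism_simple_eq_smul_id ℂ e).choose_spec

theorem endScalar_eq {e : 𝟙_ C ⟶ 𝟙_ C} {c : ℂ} (h : c • 𝟙 (𝟙_ C) = e) : endScalar e = c :=
  smul_left_injective ℂ (id_nonzero (𝟙_ C)) ((endScalar_smul e).trans h.symm)

end EndScalar

section MapEndScalar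
open Functor.LaxMonoidal Functor.OplaxMonoidal
universe v₁ u₁ v₂ u₂
variable {C : Type u₁} [Category.{v₁} C] [Abelian C] [Linear ℂ C] [MonoidalCategory C] [IsFusion C]
variable {D : Type u₂} [Category.{v₂} D] [Abelian D] [Linear ℂ D] [MonoidalCategory D] [IsFusion D]
variable (Φ : C ⥤ D) [Φ.Monoidal]

theorem endScalar_map [Φ.Linear ℂ] (e : 𝟙_ C ⟶ 𝟙_ C) :
    endScalar (ε Φ ≫ Φ.map e ≫ η Φ) = endScalar e :=
  endScalar_eq (by
    conv_rhs => rw [← endScalar_smul e]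
    rw [Φ.map_smul, Φ.map_id, Linear.smul_comp, Linear.comp_smul, Category.id_comp,
      Functor.Monoidal.ε_η])

end MapEndScalar

section Trace
universe v u
variable {C : Type u} [Category.{v} C] [Abelian C] [Linear ℂ C] [MonoidalCategory C]
  [RigidCategory C] [IsFusion C]

variable (j : PivotalStructure C)

/-- The pivotal trace is cyclic. -/
theorem pivotalTrace_comp_comm {X Y : C} (f : X ⟶ Y) (g : Y ⟶ X) :
    pivotalTrace j (f ≫ g) = pivotalTrace j (g ≫ f) := by
  unfold pivotalTrace categoricalTrace
  congr 1
  rw [Category.assoc f g, j.naturality g, ← Category.assoc f, comp_whiskerRight (f ≫ _),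
    Category.assoc, rightAdjointMate_comp_evaluation, ← whisker_exchange_assoc,
    reassoc_of% (coevaluation_comp_rightAdjointMate g), Category.assoc g f,
    comp_whiskerRight g, Category.assoc]

theorem pivotalTrace_id_of_iso {X Y : C} (i : X ≅ Y) :
    pivotalTrace j (𝟙 X) = pivotalTrace j (𝟙 Y) := by
  rw [← i.hom_inv_id, pivotalTrace_comp_comm, i.inv_hom_id]

/-- The trace of a power of the twist depends only on the isomorphism class in the center, since the
trace is cyclic and the twist is natural. -/
theorem pivotalTrace_twist_pow_of_iso {V W : Center C} (i : V ≅ W) (n : ℕ) :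
    pivotalTrace j (twist j V ^ n : End V.1) = pivotalTrace j (twist j W ^ n : End W.1) := by
  have h1 : i.hom.f ≫ i.inv.f = 𝟙 V.1 := congrArg Center.Hom.f i.hom_inv_id
  have h2 : i.inv.f ≫ i.hom.f = 𝟙 W.1 := congrArg Center.Hom.f i.inv_hom_id
  rw [← Category.comp_id (twist j V ^ n : End V.1), ← h1, ← Category.assoc, twist_pow_naturality,
    pivotalTrace_comp_comm, reassoc_of% h2]

end Trace

section MapSimple
universe v₁ u₁ v₂ u₂
variable {C : Type u₁} [Category.{v₁} C] [Abelian C] {D : Type u₂} [Category.{v₂} D] [Abelian D]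
variable (Φ : C ⥤ D)

/-- The bijection between isomorphism classes of simple objects induced by an equivalence. -/
def mapSimpleClass [Φ.IsEquivalence] (c : SimpleClass C) : SimpleClass D :=
  SimpleClass.mk (Φ.obj c.rep) (simple_obj Φ c.rep)

theorem mapSimpleClass_bijective [Φ.IsEquivalence] : Function.Bijective (mapSimpleClass Φ) := by
  constructor
  · intro c d h
    have : IsIsomorphic (Φ.obj c.rep) (Φ.obj d.rep) := Quotient.exact (congrArg Subtype.val h)
    exact SimpleClass.eq_of_iso (Φ.preimageIso this.some)
  · intro c
    have hS : Simple (Φ.objPreimage c.rep) :=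
      (simple_obj_iff Φ _).1 (Simple.of_iso (Φ.objObjPreimageIso c.rep))
    refine ⟨SimpleClass.mk _ hS, SimpleClass.eq_of_iso ?_⟩
    exact (SimpleClass.nonempty_iso_rep_mk _ _).some.symm ≪≫
      Φ.mapIso (SimpleClass.nonempty_iso_rep_mk _ hS).some.symm ≪≫ Φ.objObjPreimageIso c.rep

end MapSimple

section Transport
open Functor.LaxMonoidal Functor.OplaxMonoidal
universe v₁ u₁ v₂ u₂
variable {C : Type u₁} [Category.{v₁} C] [Abelian C] [Linear ℂ C] [MonoidalCategory C]
  [RigidCategory C] [IsFusion C]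
variable {D : Type u₂} [Category.{v₂} D] [Abelian D] [Linear ℂ D] [MonoidalCategory D]
  [RigidCategory D] [IsFusion D]
variable (Φ : C ⥤ D) [Φ.Monoidal] {jC : PivotalStructure C} {jD : PivotalStructure D}

/-- A linear monoidal functor preserving the pivotal structures preserves pivotal traces. -/
theorem pivotalTrace_map [Φ.Linear ℂ] (hΦ : PreservesPivotal Φ jC jD) {X : C} (g : X ⟶ X) :
    pivotalTrace jD (Φ.map g) = pivotalTrace jC g := by
  unfold pivotalTrace categoricalTrace
  rw [← endScalar_map Φ]
  congr 1
  have h : (ε Φ ≫ Φ.map (η_ X X✶ ≫ (g ≫ (jC.iso X).hom) ▷ X✶ ≫ ε_ X✶ X✶✶) ≫ η Φ) =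
      mapCoev Φ X ≫ Φ.map (g ≫ (jC.iso X).hom) ▷ Φ.obj X✶ ≫ mapEv Φ X✶ := by
    rw [mapCoev, mapEv]
    simp
  rw [h, ← dualityTransform_ev, ← comp_whiskerRight_assoc, Φ.map_comp, Category.assoc, hΦ,
    ← Category.assoc (Φ.map g), comp_whiskerRight _ (rightAdjointMate _), Category.assoc,
    rightAdjointMate_comp_evaluation, ← whisker_exchange_assoc,
    reassoc_of% (dualityTransform_coev Φ X)]

/-- The global dimension is invariant under pivotal equivalences, which permute the simple objects
and preserve their pivotal dimensions. -/
theorem globalDim_eq [Φ.Linear ℂ] [Φ.IsEquivalence] (hΦ : PreservesPivotal Φ jC jD) :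
    globalDim jC = globalDim jD := by
  refine finsum_eq_of_bijective (mapSimpleClass Φ) (mapSimpleClass_bijective Φ) fun c => ?_
  have i : Φ.obj (SimpleClass.rep c) ≅ (mapSimpleClass Φ c).rep :=
    (SimpleClass.nonempty_iso_rep_mk _ _).some
  rw [← pivotalTrace_map Φ hΦ, ← pivotalTrace_map Φ hΦ, Φ.map_id, Φ.map_id,
    pivotalTrace_id_of_iso jD i,
    pivotalTrace_id_of_iso jD (dualityIso Φ (SimpleClass.rep c) ≪≫ rightDualMapIso i)]

theorem pivotalTrace_twist_pow_map [Φ.Linear ℂ] [Φ.IsEquivalence]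
    (hΦ : PreservesPivotal Φ jC jD) (V : Center C) (n : ℕ) :
    pivotalTrace jC (twist jC V ^ n : End V.1) =
      pivotalTrace jD (twist jD ((centerFunctor Φ).obj V) ^ n :
        End ((centerFunctor Φ).obj V).1) := by
  rw [← pivotalTrace_map Φ hΦ, ← map_twist Φ hΦ]
  exact congrArg (pivotalTrace jD) (map_pow (Functor.mapEnd V.1 Φ) (twist jC V) n)

end Transport

end DualFS
end

theorem mainTheorem10
    {C : Type*} [Category* C] [Abelian C] [Linear ℂ C] [MonoidalCategory C]
    [MonoidalPreadditive C] [MonoidalLinear ℂ C] [RigidCategory C] [IsFusion C]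
    (jC : PivotalStructure C) (hC : IsSpherical jC)
    {D : Type*} [Category* D] [Abelian D] [Linear ℂ D] [MonoidalCategory D]
    [MonoidalPreadditive D] [MonoidalLinear ℂ D] [RigidCategory D] [IsFusion D]
    (jD : PivotalStructure D) (hD : IsSpherical jD)
    (M : Type*) [Category* M] [Abelian M] [Linear ℂ M] [IsFiniteSemisimple M]
    [MonoidalCategory.MonoidalLeftAction D M] [BilinearAction D M] (hM : IsIndecomposable D M)
    (Φ : C ⥤ D) [Φ.Monoidal] [Φ.Additive] [Φ.Linear ℂ] [Φ.IsEquivalence]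
    (hΦ : PreservesPivotal Φ jC jD) :
    letI : MonoidalCategory.MonoidalLeftAction C M := restrictAction Φ M
    (centralAction C M).IsLeftAdjoint ∧ (centralAction D M).IsLeftAdjoint ∧
    ∀ (K : ModuleEnd C M ⥤ Center C) (K' : ModuleEnd D M ⥤ Center D),
      (Nonempty (centralAction C M ⊣ K) ∧ Nonempty (centralAction D M ⊣ K')) ∨
      (Nonempty (K ⊣ centralAction C M) ∧ Nonempty (K' ⊣ centralAction D M)) →
      ∀ (F : ModuleEnd D M) (n : ℕ), 1 ≤ n →
        indicator jC K n ((dualFunctor Φ M).obj F) = indicator jD K' n F := by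
  let : MonoidalLeftAction C M := restrictAction Φ M
  refine ⟨centralAction_isLeftAdjoint, centralAction_isLeftAdjoint, fun K K' hK F n _ => ?_⟩
  have i : Nonempty ((centerFunctor Φ).obj (K.obj ((dualFunctor Φ M).obj F)) ≅ K'.obj F) := by
    rcases hK with ⟨⟨adj⟩, ⟨adj'⟩⟩ | ⟨⟨adj⟩, ⟨adj'⟩⟩
    · exact nonempty_iso_of_rightAdjoint Φ M K K' adj adj' F
    · exact nonempty_iso_of_leftAdjoint Φ M K K' adj adj' F
  unfold indicator
  rw [globalDim_eq Φ hΦ, pivotalTrace_twist_pow_map Φ hΦ, pivotalTrace_twist_pow_of_iso jD i.some]
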